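/- Let $N$ be a diffuse von Neumann algebra acting on a separable Hilbert space, with a faithful normal tracial state $\tau$, and let $\alpha=(\alpha_n)_{n\in\mathbb{Z}}$ be an action of $\mathbb{Z}$ on $N$ by $\tau$-preserving $*$-automorphisms which is - *free*: for $n\neq 0$, if $a\in N$ satisfies $ax=\alpha_n(x)a$ for all $x\in N$, then $a=0$; - *mixing*: $\tau(x\,\alpha_n(y))\to\tau(x)\tau(y)$ as $|n|\to\infty$, for all $x,y\in N$. Let $M=N\rtimes_\alpha\mathbb{Z}$, with the trace induced by $\tau$ and the canonical unitaries $u_n$, $n\in\mathbb{Z}$, implementing $\alpha$. Let $\lambda$ be the normalized Haar measure on the circle $S^1$, and identify $L(\mathbb{Z})=\{u_n\}''\subset M$ with $L^\infty(S^1,\lambda)$ by sending $u_n$ to the function $t\mapsto t^n$. Let $\eta$ be a finite measure representing the left–right measure of $L(\mathbb{Z})\subset M$. That is, there is a finite Borel measure $\rho$ on $S^1\times S^1$ and a unitary from $L^2(M)$ onto a direct integral $\int^{\oplus}_{S^1\times S^1}\mathcal{H}_{t,s}\,d\rho(t,s)$ of separable Hilbert spaces that are non-zero for $\rho$-almost every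 $(t,s)$, under which $\zeta\mapsto u_m\zeta u_n$ becomes multiplication by $(t,s)\mapsto t^m s^n$ for all $m,n\in\mathbb{Z}$; and $\eta$ is a finite Borel measure having the same null sets as the restriction of $\rho$ to the complement of the diagonal of $S^1\times S^1$. Then $\eta$ has a disintegration $\{\eta^t\}_{t\in S^1}$ with respect to the first coordinate projection $\pi_1$ and $\lambda$, that is, a family of $\sigma$-finite Borel measures on $S^1\times S^1$ such that $\eta^t$ is concentrated on $\{t\}\times S^1$ for $\lambda$-almost every $t$ and, for every Borel function $f\geq 0$ on $S^1\times S^1$, the function $t\mapsto\int f\,d\eta^t$ is Borel and $\int f\,d\eta=\int_{S^1}\left(\int f\,d\eta^t\right)d\lambda(t)$. Moreover, for every such disintegration, for $\lambda$-almost every $t\in S^1$ the measure $\tilde\eta^t$ on $S^1$, obtained by restricting $\eta^t$ to $\{t\}\times S^1\cong S^1$, is a mixing (Rajchman) measure: it is finite and $\int_{S^1}s^n\,d\tilde\eta^t(s)\to 0$ as $|n|\to\infty$. -/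

import Mathlib

open MeasureTheory Filter Topology
open scoped ENNReal InnerProductSpace ComplexOrder

noncomputable section

namespace CrossedMixing

universe u

/-! ### Von Neumann algebras: generation, positive functionals, traces, the standard space -/

section VonNeumann

variable {H : Type u} [NormedAddCommGroup H] [InnerProductSpace ℂ H] [CompleteSpace H]

/-- The underlying ⋆-algebra of a von Neumann algebra, as a type. -/
abbrev Elem (M : VonNeumannAlgebra H) : Type u := M.toStarSubalgebra

/-- The von Neumann algebra generated by a set of bounded operators: the double commutant of the
set together with its adjoints. -/
def vnGenerate (S : Set (H →L[ℂ] H)) : VonNeumannAlgebra H where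
  toStarSubalgebra :=
    StarSubalgebra.centralizer ℂ (StarSubalgebra.centralizer ℂ S : Set (H →L[ℂ] H))
  centralizer_centralizer' := by
    change Set.centralizer (Set.centralizer
      ((StarSubalgebra.centralizer ℂ
        (StarSubalgebra.centralizer ℂ S : Set (H →L[ℂ] H)) : StarSubalgebra ℂ (H →L[ℂ] H)) :
          Set (H →L[ℂ] H))) = _
    rw [StarSubalgebra.coe_centralizer_centralizer, Set.centralizer_centralizer_centralizer]
    exact (StarSubalgebra.coe_centralizer_centralizer ℂ S).symm

theorem coe_vnGenerate (S : Set (H →L[ℂ] H)) :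
    ((vnGenerate S).toStarSubalgebra : Set (H →L[ℂ] H)) =
      Set.centralizer (Set.centralizer (S ∪ star S)) :=
  StarSubalgebra.coe_centralizer_centralizer ℂ S

theorem subset_vnGenerate (S : Set (H →L[ℂ] H)) :
    S ⊆ ((vnGenerate S).toStarSubalgebra : Set (H →L[ℂ] H)) := by
  rw [coe_vnGenerate]
  exact Set.subset_union_left.trans Set.subset_centralizer_centralizer

theorem isClosed_elem (M : VonNeumannAlgebra H) :
    IsClosed (M.toStarSubalgebra : Set (H →L[ℂ] H)) := by
  rw [VonNeumannAlgebra.coe_toStarSubalgebra, ← M.centralizer_centralizer]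
  exact Set.isClosed_centralizer _

theorem norm_starAlgEquiv (M : VonNeumannAlgebra H) (f : Elem M ≃⋆ₐ[ℂ] Elem M) (x : Elem M) :
    ‖(f x : H →L[ℂ] H)‖ = ‖(x : H →L[ℂ] H)‖ := by
  have : IsClosed (M.toStarSubalgebra : Set (H →L[ℂ] H)) := isClosed_elem M
  exact StarAlgEquiv.norm_map f x

/-- `M` is diffuse: it has no minimal projections. -/
def IsDiffuse (M : VonNeumannAlgebra H) : Prop :=
  ∀ p ∈ M, IsStarProjection p → p ≠ 0 →
    ∃ q ∈ M, IsStarProjection q ∧ q ≠ 0 ∧ q ≠ p ∧ p * q = q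

/-- A positive linear functional on a von Neumann algebra. -/
structure PositiveFunctional (M : VonNeumannAlgebra H) where
  toLin : Elem M →ₗ[ℂ] ℂ
  nonneg : ∀ x : Elem M, (x : H →L[ℂ] H).IsPositive → 0 ≤ toLin x

namespace PositiveFunctional

instance (M : VonNeumannAlgebra H) : CoeFun (PositiveFunctional M) (fun _ => Elem M → ℂ) :=
  ⟨fun φ => φ.toLin⟩

variable {M : VonNeumannAlgebra H} (φ : PositiveFunctional M)

theorem nonneg_star_mul (x : Elem M) : 0 ≤ φ (star x * x) :=
  φ.nonneg _ (ContinuousLinearMap.isPositive_adjoint_comp_self (x : H →L[ℂ] H))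

theorem map_star (x : Elem M) : φ (star x) = star (φ x) := by
  have key : ∀ z : ℂ, (φ (star (x + z • (1 : Elem M)) * (x + z • (1 : Elem M)))).im = 0 :=
    fun z => (Complex.nonneg_iff.1 (φ.nonneg_star_mul _)).2.symm
  have e : ∀ z : ℂ, φ (star (x + z • (1 : Elem M)) * (x + z • (1 : Elem M))) =
      φ (star x * x) + z * φ (star x) + (star z * φ x + star z * z * φ 1) := by
    intro z
    have : star (x + z • (1 : Elem M)) * (x + z • (1 : Elem M)) =
        star x * x + z • star x + (star z • x + (star z * z) • (1 : Elem M)) := by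
      simp only [star_add, star_smul, star_one, add_mul, mul_add, smul_mul_assoc, mul_smul_comm,
        mul_one, one_mul, smul_add, smul_smul]
      rw [mul_comm z (star z)]
      abel
    rw [this]
    simp only [_root_.map_add, _root_.map_smul, smul_eq_mul]
  have h0 := key 0
  have h1 := key 1
  have h2 := key Complex.I
  have h3 := key (-1)
  have h4 := key (-Complex.I)
  rw [e] at h0 h1 h2 h3 h4
  simp at h0 h1 h2 h3 h4
  apply Complex.ext
  · simp; linarith
  · simp; linarith

/-- A copy of `M`, carrying the semi-inner product `⟪x, y⟫ = φ (x⋆ y)` (linear in the second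
variable). -/
def PreL2 (_φ : PositiveFunctional M) : Type u := Elem M

instance : AddCommGroup φ.PreL2 := inferInstanceAs (AddCommGroup (Elem M))
instance : Module ℂ φ.PreL2 := inferInstanceAs (Module ℂ (Elem M))

/-- The identity map from `M` to its copy. -/
def toPreL2 : Elem M ≃ₗ[ℂ] φ.PreL2 := LinearEquiv.refl ℂ _

/-- The semi-inner product given by `φ`. -/
abbrev preL2Core : PreInnerProductSpace.Core ℂ φ.PreL2 where
  inner x y := φ (star (φ.toPreL2.symm x) * φ.toPreL2.symm y)
  conj_inner_symm x y := by
    change star _ = _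
    rw [← φ.map_star]; simp
  re_inner_nonneg x := (Complex.nonneg_iff.1 (φ.nonneg_star_mul _)).1
  add_left x y z := by
    rw [_root_.map_add, star_add, add_mul, _root_.map_add]
  smul_left x y r := by
    rw [_root_.map_smul, star_smul, smul_mul_assoc, _root_.map_smul]; rfl

instance : SeminormedAddCommGroup φ.PreL2 :=
  InnerProductSpace.Core.toSeminormedAddCommGroup (c := φ.preL2Core)
instance : InnerProductSpace ℂ φ.PreL2 :=
  InnerProductSpace.ofCore φ.preL2Core

/-- The Hilbert space `L²(M, φ)`: the completion of `M` in the norm `‖x‖₂ = φ (x⋆ x) ^ (1/2)`. -/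
abbrev L2 : Type u := UniformSpace.Completion φ.PreL2

/-- The canonical map `M → L²(M, φ)`. -/
def toL2 (x : Elem M) : φ.L2 := ((φ.toPreL2 x : φ.PreL2) : UniformSpace.Completion φ.PreL2)

theorem inner_toL2 (x y : Elem M) : ⟪φ.toL2 x, φ.toL2 y⟫_ℂ = φ (star x * y) :=
  UniformSpace.Completion.inner_coe _ _

/-- `φ` is a faithful normal tracial state.  Normality is continuity in the ultraweak
(`σ`-weak) topology: `φ` has the form `x ↦ ∑ ⟪ηₙ, x ξₙ⟫` with `∑ ‖ξₙ‖² < ∞`, `∑ ‖ηₙ‖² < ∞`. -/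
structure IsFaithfulNormalTracialState : Prop where
  map_one : φ 1 = 1
  tracial : ∀ x y, φ (x * y) = φ (y * x)
  faithful : ∀ x, φ (star x * x) = 0 → x = 0
  normal : ∃ ξ η : ℕ → H, (Summable fun n => ‖ξ n‖ ^ 2) ∧ (Summable fun n => ‖η n‖ ^ 2) ∧
    ∀ x : Elem M, HasSum (fun n => ⟪η n, (x : H →L[ℂ] H) (ξ n)⟫_ℂ) (φ x)

end PositiveFunctional

end VonNeumann

/-! ### Actions of `ℤ` -/

section Action

variable {H : Type u} [NormedAddCommGroup H] [InnerProductSpace ℂ H] [CompleteSpace H]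

/-- An action of `ℤ` on a von Neumann algebra by `⋆`-automorphisms. -/
abbrev IntAction (N : VonNeumannAlgebra H) : Type u :=
  Multiplicative ℤ →* (Elem N ≃⋆ₐ[ℂ] Elem N)

variable {N : VonNeumannAlgebra H}

/-- The automorphism `αₙ` of the action `α`. -/
def IntAction.at (α : IntAction N) (n : ℤ) : Elem N ≃⋆ₐ[ℂ] Elem N :=
  α (Multiplicative.ofAdd n)

/-- The action preserves `τ`. -/
def IntAction.Preserves (α : IntAction N) (τ : PositiveFunctional N) : Prop :=
  ∀ (n : ℤ) (x : Elem N), τ (α.at n x) = τ x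

/-- The action is free (properly outer): for `n ≠ 0`, only `a = 0` satisfies
`a x = αₙ(x) a` for all `x`. -/
def IntAction.IsFree (α : IntAction N) : Prop :=
  ∀ n : ℤ, n ≠ 0 → ∀ a : Elem N, (∀ x : Elem N, a * x = α.at n x * a) → a = 0

/-- The action is mixing with respect to `τ`: `τ(x αₙ(y)) → τ(x) τ(y)` as `|n| → ∞`. -/
def IntAction.IsMixing (α : IntAction N) (τ : PositiveFunctional N) : Prop :=
  ∀ x y : Elem N, Tendsto (fun n : ℤ => τ (x * α.at n y)) cofinite (𝓝 (τ x * τ y))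

/-! ### The crossed product `N ⋊ ℤ` -/

variable (H) in
/-- The Hilbert space `ℓ²(ℤ, H) = H ⊗ ℓ²(ℤ)`. -/
abbrev EllTwo : Type u := lp (fun _ : ℤ => H) 2

/-- The representation `π` of `N` on `ℓ²(ℤ, H)`: `(π(x) ξ)(n) = α₋ₙ(x) (ξ n)`. -/
def piRep (α : IntAction N) (x : Elem N) : EllTwo H →L[ℂ] EllTwo H :=
  lp.mapCLM 2 (fun n : ℤ => ((α.at (-n) x : Elem N) : H →L[ℂ] H))
    (K := ‖(x : H →L[ℂ] H)‖) (norm_nonneg _)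
    (fun n => (norm_starAlgEquiv N (α.at (-n)) x).le)

theorem piRep_apply (α : IntAction N) (x : Elem N) (ξ : EllTwo H) (n : ℤ) :
    piRep α x ξ n = ((α.at (-n) x : Elem N) : H →L[ℂ] H) (ξ n) := rfl

theorem memlp_shift (m : ℤ) (ξ : EllTwo H) :
    Memℓp (fun n : ℤ => (ξ : ∀ _ : ℤ, H) (n - m)) 2 := by
  apply memℓp_gen
  have h := (lp.memℓp ξ).summable (by norm_num)
  exact (Equiv.subRight m).summable_iff.2 h

variable (H) in
/-- The translation `λₘ` on `ℓ²(ℤ, H)`: `(λₘ ξ)(n) = ξ(n - m)`. -/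
def shiftOp (m : ℤ) : EllTwo H →L[ℂ] EllTwo H :=
  LinearMap.mkContinuous
    { toFun := fun ξ => ⟨fun n : ℤ => (ξ : ∀ _ : ℤ, H) (n - m), memlp_shift m ξ⟩
      map_add' := fun _ _ => rfl
      map_smul' := fun _ _ => rfl } 1 (by
    intro ξ
    rw [one_mul, lp.norm_eq_tsum_rpow (by norm_num), lp.norm_eq_tsum_rpow (by norm_num)]
    apply le_of_eq
    congr 1
    exact (Equiv.subRight m).tsum_eq (fun n : ℤ => ‖(ξ : ∀ _ : ℤ, H) n‖ ^ (2 : ℝ≥0∞).toReal))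

theorem shiftOp_apply (m : ℤ) (ξ : EllTwo H) (n : ℤ) : shiftOp H m ξ n = ξ (n - m) := rfl

theorem shiftOp_mul (m n : ℤ) : shiftOp H m * shiftOp H n = shiftOp H (m + n) := by
  ext ξ k
  exact congrArg (ξ : ∀ _ : ℤ, H) (show k - m - n = k - (m + n) by ring)

theorem shiftOp_zero : shiftOp H 0 = 1 := by
  ext ξ k
  exact congrArg (ξ : ∀ _ : ℤ, H) (sub_zero k)

theorem star_shiftOp (m : ℤ) : star (shiftOp H m) = shiftOp H (-m) := by
  rw [ContinuousLinearMap.star_eq_adjoint]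
  symm
  rw [ContinuousLinearMap.eq_adjoint_iff]
  intro ξ ζ
  rw [lp.inner_eq_tsum, lp.inner_eq_tsum,
    ← (Equiv.subRight m).tsum_eq (fun n : ℤ => ⟪(shiftOp H (-m) ξ) n, ζ n⟫_ℂ)]
  refine tsum_congr fun n => ?_
  simp only [Equiv.subRight_apply, shiftOp_apply]
  rw [show n - m - -m = n by ring]

/-- The generators `π(x)`, `x ∈ N`, and `λₘ`, `m ∈ ℤ`, of the crossed product. -/
def crossedGen (α : IntAction N) : Set (EllTwo H →L[ℂ] EllTwo H) :=
  Set.range (piRep α) ∪ Set.range (shiftOp H)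

/-- The crossed product von Neumann algebra `N ⋊_α ℤ` on `ℓ²(ℤ, H)`. -/
def crossedProduct (α : IntAction N) : VonNeumannAlgebra (EllTwo H) :=
  vnGenerate (crossedGen α)

/-- The canonical unitary `u = λ₁` of the crossed product; `uⁿ = λₙ`, and `u` generates the
von Neumann subalgebra `L(ℤ)`. -/
def canonicalUnitary (α : IntAction N) : unitary (Elem (crossedProduct α)) :=
  ⟨⟨shiftOp H 1, subset_vnGenerate _ (Or.inr ⟨1, rfl⟩)⟩, by
    rw [Unitary.mem_iff]
    constructor <;> apply Subtype.ext
    · change star (shiftOp H 1) * shiftOp H 1 = 1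
      rw [star_shiftOp, shiftOp_mul, neg_add_cancel, shiftOp_zero]
    · change shiftOp H 1 * star (shiftOp H 1) = 1
      rw [star_shiftOp, shiftOp_mul, add_neg_cancel, shiftOp_zero]⟩

variable (H) in
/-- The embedding of `H` into `ℓ²(ℤ, H)` as the coordinate at `0`. -/
def deltaZero : H →L[ℂ] EllTwo H := lp.singleContinuousLinearMap ℂ (fun _ : ℤ => H) 2 0

theorem adjoint_deltaZero (ξ : EllTwo H) : (deltaZero H).adjoint ξ = ξ 0 := by
  refine ext_inner_left ℂ fun v => ?_
  rw [ContinuousLinearMap.adjoint_inner_right]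
  exact lp.inner_single_left (𝕜 := ℂ) (G := fun _ : ℤ => H) (0 : ℤ) v ξ

variable (H) in
/-- The `(0, 0)` matrix entry of an operator on `ℓ²(ℤ, H)`. -/
def entryZero (T : EllTwo H →L[ℂ] EllTwo H) : H →L[ℂ] H :=
  (deltaZero H).adjoint ∘L T ∘L deltaZero H

/-- The diagonal operator `c ⊗ 1` on `ℓ²(ℤ, H)`. -/
def constOp (c : H →L[ℂ] H) : EllTwo H →L[ℂ] EllTwo H :=
  lp.mapCLM 2 (fun _ : ℤ => c) (K := ‖c‖) (norm_nonneg _) (fun _ => le_rfl)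

theorem constOp_apply (c : H →L[ℂ] H) (ξ : EllTwo H) (n : ℤ) : constOp c ξ n = c (ξ n) := rfl

theorem star_constOp (c : H →L[ℂ] H) : star (constOp c) = constOp (star c) := by
  rw [ContinuousLinearMap.star_eq_adjoint]
  symm
  rw [ContinuousLinearMap.eq_adjoint_iff]
  intro ξ ζ
  rw [lp.inner_eq_tsum, lp.inner_eq_tsum]
  refine tsum_congr fun n => ?_
  rw [constOp_apply, constOp_apply, ContinuousLinearMap.star_eq_adjoint,
    ContinuousLinearMap.adjoint_inner_left]

theorem constOp_comm_gen (α : IntAction N) {c : H →L[ℂ] H}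
    (hc : c ∈ Set.centralizer (N : Set (H →L[ℂ] H))) {T : EllTwo H →L[ℂ] EllTwo H}
    (hT : T ∈ crossedGen α) : T * constOp c = constOp c * T := by
  rcases hT with ⟨x, rfl⟩ | ⟨m, rfl⟩
  · ext ξ n
    exact congrArg (fun S : H →L[ℂ] H => S (ξ n)) (hc _ (α.at (-n) x).2)
  · rfl

theorem constOp_mem_centralizer (α : IntAction N) {c : H →L[ℂ] H}
    (hc : c ∈ Set.centralizer (N : Set (H →L[ℂ] H))) :
    constOp c ∈ Set.centralizer (crossedGen α ∪ star (crossedGen α)) := by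
  have hc' : star c ∈ Set.centralizer (N : Set (H →L[ℂ] H)) := by
    intro y hy
    have := congrArg star (hc (star y) (star_mem (S := VonNeumannAlgebra H) hy))
    simpa using this.symm
  rintro T (hT | hT)
  · exact constOp_comm_gen α hc hT
  · have h := congrArg star (constOp_comm_gen α hc' hT)
    rw [star_mul, star_mul, star_star, star_constOp, star_star] at h
    exact h.symm

/-- The `(0, 0)` entry of an element of the crossed product lies in `N`. -/
theorem entryZero_mem (α : IntAction N) (T : Elem (crossedProduct α)) :
    entryZero H (T : EllTwo H →L[ℂ] EllTwo H) ∈ N.toStarSubalgebra := by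
  have hT : (T : EllTwo H →L[ℂ] EllTwo H) ∈
      Set.centralizer (Set.centralizer (crossedGen α ∪ star (crossedGen α))) := by
    rw [← coe_vnGenerate]; exact T.2
  change _ ∈ (N : Set (H →L[ℂ] H))
  rw [← N.centralizer_centralizer]
  intro c hc
  have h := hT _ (constOp_mem_centralizer α hc)
  have h1 : ∀ v, constOp c (deltaZero H v) = deltaZero H (c v) := by
    intro v
    ext n
    rw [constOp_apply]
    change c ((lp.single 2 (0 : ℤ) v : EllTwo H) n) = (lp.single 2 (0 : ℤ) (c v) : EllTwo H) n
    rw [lp.single_apply, lp.single_apply]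
    by_cases hn : n = 0
    · subst hn; simp
    · simp [hn]
  ext v
  have h2 := congrArg (fun S : EllTwo H →L[ℂ] EllTwo H => (S (deltaZero H v)) 0) h
  have h3 : c ((deltaZero H).adjoint ((T : EllTwo H →L[ℂ] EllTwo H) (deltaZero H v))) =
      (deltaZero H).adjoint ((T : EllTwo H →L[ℂ] EllTwo H) (deltaZero H (c v))) := by
    rw [adjoint_deltaZero, adjoint_deltaZero, ← h1]
    exact h2
  exact h3

/-- The normal conditional expectation of `N ⋊ ℤ` onto `N`, as an `N`-valued linear map. -/
def condExpN (α : IntAction N) : Elem (crossedProduct α) →ₗ[ℂ] Elem N where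
  toFun T := ⟨entryZero H (T : EllTwo H →L[ℂ] EllTwo H), entryZero_mem α T⟩
  map_add' S T := by
    apply Subtype.ext
    ext v
    simp [entryZero]
  map_smul' c T := by
    apply Subtype.ext
    ext v
    simp [entryZero]

/-- The functional on `N ⋊ ℤ` induced by `τ`, namely `τ ∘ E_N`; on the generators it is
`π(x) λₙ ↦ τ(x)` for `n = 0` and `0` for `n ≠ 0`. -/
def crossedTrace (τ : PositiveFunctional N) (α : IntAction N) :
    PositiveFunctional (crossedProduct α) where
  toLin := τ.toLin ∘ₗ condExpN α
  nonneg _ hT := τ.nonneg _ (hT.adjoint_conj (deltaZero H))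

end Action

/-! ### Direct integrals of Hilbert spaces -/

section DirectIntegral

/-- A measurable field of separable Hilbert spaces over `Z`, given by a fundamental sequence of
sections.  (Every separable Hilbert space has an isomorphic copy in `Type`.) -/
structure MeasurableHilbertField (Z : Type*) [MeasurableSpace Z] where
  fiber : Z → Type
  [normed : ∀ z, NormedAddCommGroup (fiber z)]
  [innerProd : ∀ z, InnerProductSpace ℂ (fiber z)]
  [complete : ∀ z, CompleteSpace (fiber z)]
  /-- the fundamental sequence -/
  fund : ℕ → ∀ z, fiber z
  measurable_inner : ∀ i j, Measurable fun z => ⟪fund i z, fund j z⟫_ℂ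
  total : ∀ z, (Submodule.span ℂ (Set.range fun i => fund i z)).topologicalClosure = ⊤

attribute [instance] MeasurableHilbertField.normed MeasurableHilbertField.innerProd
  MeasurableHilbertField.complete

variable {Z : Type*} [MeasurableSpace Z]

/-- Square-integrable measurable sections of a field: the vectors (before identifying sections
which agree almost everywhere) of the direct integral `∫^⊕ fiber z dρ(z)`. -/
structure MeasurableHilbertField.IsL2Section (F : MeasurableHilbertField Z) (ρ : Measure Z)
    (f : ∀ z, F.fiber z) : Prop where
  measurable : ∀ i, AEMeasurable (fun z => ⟪F.fund i z, f z⟫_ℂ) ρ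
  integrable : Integrable (fun z => ‖f z‖ ^ 2) ρ

/-- A unitary operator from the Hilbert space `K` onto the direct integral `∫^⊕ fiber z dρ(z)`,
in terms of representatives: `toSection ζ` is a section representing the image of `ζ`. -/
structure DirectIntegralIso (F : MeasurableHilbertField Z) (ρ : Measure Z)
    (K : Type*) [NormedAddCommGroup K] [InnerProductSpace ℂ K] where
  toSection : K → ∀ z, F.fiber z
  isL2Section : ∀ ζ, F.IsL2Section ρ (toSection ζ)
  map_add : ∀ ζ ζ', ∀ᵐ z ∂ρ, toSection (ζ + ζ') z = toSection ζ z + toSection ζ' z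
  map_smul : ∀ (c : ℂ) ζ, ∀ᵐ z ∂ρ, toSection (c • ζ) z = c • toSection ζ z
  norm_sq : ∀ ζ, ‖ζ‖ ^ 2 = ∫ z, ‖toSection ζ z‖ ^ 2 ∂ρ
  surjective : ∀ f, F.IsL2Section ρ f → ∃ ζ, ∀ᵐ z ∂ρ, toSection ζ z = f z

end DirectIntegral

/-! ### The left–right measure -/

section LeftRight

variable {K : Type u} [NormedAddCommGroup K] [InnerProductSpace ℂ K] [CompleteSpace K]

/-- Let `M` be a von Neumann algebra with trace `φ`, and `v ∈ M` a Haar unitary generating the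
abelian subalgebra `A = {v}''`; identify `A` with `L^∞(S¹)` so that `v` is the coordinate
function, where `S¹ = ℝ/ℤ` and the coordinate function is `t ↦ e^{2πit} = fourier 1 t`.

The finite measure `μ` on `S¹ × S¹` is a *left–right measure* of `A` (a representative of the
class `[η|_{Δᶜ}]`) if it is equivalent to the restriction to the complement of the diagonal of a
finite measure `ρ` over which `L²(M)` is a direct integral with non-zero fibres, in such a way that
`vᵐ ζ vⁿ` corresponds to multiplication by `(t, s) ↦ tᵐ sⁿ`.  (The functions `tᵐ sⁿ` generate
`L^∞(S¹ × S¹, ρ)`, so that the diagonalizable operators are exactly `(A ∪ JAJ)''`; the vectors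
`ζ ∈ M` are dense in `L²(M)`, so that it is enough to consider these.) -/
def IsLeftRightMeasure {M : VonNeumannAlgebra K} (φ : PositiveFunctional M)
    (v : unitary (Elem M)) (μ : Measure (UnitAddCircle × UnitAddCircle)) : Prop :=
  IsFiniteMeasure μ ∧
  ∃ (ρ : Measure (UnitAddCircle × UnitAddCircle)) (_ : IsFiniteMeasure ρ)
    (F : MeasurableHilbertField (UnitAddCircle × UnitAddCircle))
    (U : DirectIntegralIso F ρ φ.L2),
    (∀ᵐ z ∂ρ, Nontrivial (F.fiber z)) ∧
    (∀ (m n : ℤ) (y : Elem M), ∀ᵐ z ∂ρ,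
      U.toSection (φ.toL2 (((v ^ m : unitary (Elem M)) : Elem M) * y *
          ((v ^ n : unitary (Elem M)) : Elem M))) z =
        ((fourier m z.1 : ℂ) * (fourier n z.2 : ℂ)) • U.toSection (φ.toL2 y) z) ∧
    μ ≪ ρ.restrict (Set.diagonal UnitAddCircle)ᶜ ∧
    ρ.restrict (Set.diagonal UnitAddCircle)ᶜ ≪ μ

end LeftRight

/-! ### Disintegration and mixing measures -/

/-- `κ` is a disintegration of the measure `β` with respect to the map `T` and the measure `μ`. -/
structure IsDisintegration {X Y : Type*} [MeasurableSpace X] [MeasurableSpace Y]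
    (β : Measure X) (T : X → Y) (μ : Measure Y) (κ : Y → Measure X) : Prop where
  sigmaFinite : ∀ y, SigmaFinite (κ y)
  concentrated : ∀ᵐ y ∂μ, κ y {x | T x ≠ y} = 0
  measurable : ∀ f : X → ℝ≥0∞, Measurable f → Measurable fun y => ∫⁻ x, f x ∂(κ y)
  lintegral_eq : ∀ f : X → ℝ≥0∞, Measurable f →
    ∫⁻ x, f x ∂β = ∫⁻ y, ∫⁻ x, f x ∂(κ y) ∂μ

/-- The restriction of a measure on `X × X` to the fibre `{t} × X`, as a measure on `X`. -/
def fiberMeasure {X : Type*} [MeasurableSpace X] (ν : Measure (X × X)) (t : X) : Measure X :=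
  ν.comap (Prod.mk t)

/-- A mixing (Rajchman) measure on the circle: a finite measure whose Fourier coefficients
`∫ sⁿ dν(s)` tend to zero as `|n| → ∞`. -/
def IsMixingMeasure (ν : Measure UnitAddCircle) : Prop :=
  IsFiniteMeasure ν ∧ Tendsto (fun n : ℤ => ∫ s, (fourier n s : ℂ) ∂ν) cofinite (𝓝 0)

end CrossedMixing

end

open CrossedMixing

noncomputable section

namespace CrossedMixing

/-! ### Fourier analysis on the circle and the two-dimensional torus. -/

section Circle

local notation "𝕋" => UnitAddCircle

/-! For `x ∈ N` with `τ x = 0`, let `σ` be the spectral measure of the vector `x ∈ L²(M)` under the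
two-sided action of `L(ℤ)`. Its coefficients are `⟪x, u_m x u_n⟫`, and since `u_m x u_n = α_m(x)
u_{m+n}` they equal `τ(x⋆ α_m(x))` when `m + n = 0` and vanish otherwise. A measure on the torus
with coefficients supported on the antidiagonal is invariant under simultaneous rotation of both
coordinates. Hence `σ` is the image of Haar measure times `ν` under `(t, r) ↦ (t, t - r)`, where `ν`
is the law of `t - s` under `σ` (`eq_map_prod_of_integral_eq_zero`). The coefficients of `ν` are
`τ(x⋆ α_n(x))`, so mixing of the action makes `ν` a mixing measure.

Such vectors see everything off the diagonal: the products `u_k w` with `w ∈ N` span a dense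
subspace, left multiplication by `u_k` only changes a section by a unimodular factor, and the vector
`1` lives on the diagonal because `u 1 u⁻¹ = 1`. Countably many trace-zero `x_j` therefore detect
all off-diagonal null sets of `ρ` (`IsBimodular.exists_seq`). A weighted sum of the corresponding
`ν_j` is one mixing measure `ν` such that `η` is absolutely continuous with respect to the image of
Haar times `ν`.

Multiplying the obvious disintegration of that image by the density of `η` disintegrates `η`. Its
fibres are almost surely finite, hence integrable multiples of a reflected translate of `ν`, and an
integrable multiple of a mixing measure is mixing (`IsMixingMeasure.tendsto_integral_fourier_mul`).
Almost everywhere uniqueness of the fibres (`IsDisintegration.ae_map_snd_eq`) carries this to every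
disintegration. -/

theorem fourier_sub_apply (n : ℤ) (x y : 𝕋) :
    (fourier n (x - y) : ℂ) = fourier n x * fourier (-n) y := by
  rw [fourier_apply, fourier_apply, fourier_apply, ← Circle.coe_mul, ← AddCircle.toCircle_add]
  congr 2
  rw [smul_sub, neg_smul, sub_eq_add_neg]

theorem norm_fourier_apply (n : ℤ) (x : 𝕋) : ‖(fourier n x : ℂ)‖ = 1 := by
  rw [fourier_apply]; exact Circle.norm_coe _

theorem fourier_one_injective {x y : 𝕋} (h : (fourier 1 x : ℂ) = fourier 1 y) : x = y := by
  rw [fourier_one, fourier_one] at h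
  exact AddCircle.injective_toCircle one_ne_zero (Circle.coe_injective h)

/-- The character `(t, s) ↦ tᵐ sⁿ` of the two-dimensional torus. -/
def torusChar (m n : ℤ) : BoundedContinuousFunction (𝕋 × 𝕋) ℂ :=
  BoundedContinuousFunction.mkOfCompact
    ⟨fun z => (fourier m z.1 : ℂ) * fourier n z.2, by fun_prop⟩

theorem torusChar_apply (m n : ℤ) (z : 𝕋 × 𝕋) :
    torusChar m n z = (fourier m z.1 : ℂ) * fourier n z.2 := rfl

/-- The span of the characters of the two-dimensional torus, as a star subalgebra. -/
def torusCharAlgebra : StarSubalgebra ℂ (BoundedContinuousFunction (𝕋 × 𝕋) ℂ) where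
  carrier := Submodule.span ℂ (Set.range fun p : ℤ × ℤ => torusChar p.1 p.2)
  mul_mem' {f g} hf hg := by
    have h := Submodule.mul_mem_mul hf hg
    rw [Submodule.span_mul_span] at h
    refine Submodule.span_mono ?_ h
    rintro _ ⟨_, ⟨p, rfl⟩, _, ⟨q, rfl⟩, rfl⟩
    refine ⟨p + q, ?_⟩
    ext z
    simp only [torusChar_apply, BoundedContinuousFunction.mul_apply, Prod.fst_add, Prod.snd_add,
      fourier_add]
    ring
  add_mem' := add_mem
  algebraMap_mem' c := by
    rw [Algebra.algebraMap_eq_smul_one]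
    refine Submodule.smul_mem _ _ (Submodule.subset_span ⟨0, ?_⟩)
    ext z
    simp [torusChar_apply]
  star_mem' {f} hf := by
    change f ∈ Submodule.span ℂ (Set.range fun p : ℤ × ℤ => torusChar p.1 p.2) at hf
    change star f ∈ Submodule.span ℂ (Set.range fun p : ℤ × ℤ => torusChar p.1 p.2)
    induction hf using Submodule.span_induction with
    | mem f hf =>
      obtain ⟨p, rfl⟩ := hf
      refine Submodule.subset_span ⟨-p, ?_⟩
      ext z
      simp only [torusChar_apply, Prod.fst_neg, Prod.snd_neg, fourier_neg,
        BoundedContinuousFunction.star_apply, star_mul', RCLike.star_def]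
    | zero => simp
    | add f g _ _ hf hg => rw [star_add]; exact add_mem hf hg
    | smul c f _ hf => rw [star_smul]; exact Submodule.smul_mem _ _ hf

/-- A finite measure on the two-dimensional torus is determined by its Fourier coefficients. -/
theorem ext_of_integral_fourier_mul_fourier {P Q : Measure (𝕋 × 𝕋)} [IsFiniteMeasure P]
    [IsFiniteMeasure Q]
    (h : ∀ m n : ℤ, ∫ z, (fourier m z.1 : ℂ) * fourier n z.2 ∂P =
      ∫ z, (fourier m z.1 : ℂ) * fourier n z.2 ∂Q) : P = Q := by
  refine ext_of_forall_mem_subalgebra_integral_eq_of_pseudoEMetric_complete_countable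
    (𝕜 := ℂ) (A := torusCharAlgebra) ?_ ?_
  · intro z w hzw
    have : z.1 ≠ w.1 ∨ z.2 ≠ w.2 := by
      by_contra! hc
      exact hzw (Prod.ext hc.1 hc.2)
    rcases this with h1 | h2
    · refine ⟨_, ⟨_, ⟨torusChar 1 0, Submodule.subset_span ⟨(1, 0), rfl⟩, rfl⟩, rfl⟩, fun he => h1 ?_⟩
      change torusChar 1 0 z = torusChar 1 0 w at he
      simp only [torusChar_apply, fourier_zero, mul_one] at he
      exact fourier_one_injective he
    · refine ⟨_, ⟨_, ⟨torusChar 0 1, Submodule.subset_span ⟨(0, 1), rfl⟩, rfl⟩, rfl⟩, fun he => h2 ?_⟩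
      change torusChar 0 1 z = torusChar 0 1 w at he
      simp only [torusChar_apply, fourier_zero, one_mul] at he
      exact fourier_one_injective he
  · intro g hg
    change g ∈ Submodule.span ℂ (Set.range fun p : ℤ × ℤ => torusChar p.1 p.2) at hg
    induction hg using Submodule.span_induction with
    | mem f hf =>
      obtain ⟨p, rfl⟩ := hf
      exact h p.1 p.2
    | zero => simp
    | add f g _ _ hf hg =>
      simp only [BoundedContinuousFunction.add_apply]
      rw [integral_add (f.integrable P) (g.integrable P),
        integral_add (f.integrable Q) (g.integrable Q), hf, hg]
    | smul c f _ hf =>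
      simp only [BoundedContinuousFunction.smul_apply]
      rw [integral_smul, integral_smul, hf]

/-- An integrable multiple of a mixing measure has Fourier coefficients tending to zero. -/
theorem IsMixingMeasure.tendsto_integral_fourier_mul {ν : Measure 𝕋} (hν : IsMixingMeasure ν)
    {h : 𝕋 → ℂ} (hh : Integrable h ν) :
    Tendsto (fun n : ℤ => ∫ s, (fourier n s : ℂ) * h s ∂ν) cofinite (𝓝 0) := by
  have := hν.1
  have hint : ∀ (n : ℤ) {f : 𝕋 → ℂ}, Integrable f ν →
      Integrable (fun s => (fourier n s : ℂ) * f s) ν := fun n f hf =>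
    hf.bdd_mul (c := 1) (map_continuous (fourier n)).aestronglyMeasurable
      (ae_of_all _ fun s => (norm_fourier_apply n s).le)
  have key : ∀ {f g : 𝕋 → ℂ}, Integrable f ν → Integrable g ν → ∀ n : ℤ,
      ‖(∫ s, (fourier n s : ℂ) * f s ∂ν) - ∫ s, (fourier n s : ℂ) * g s ∂ν‖ ≤
        ∫ s, ‖f s - g s‖ ∂ν := by
    intro f g hf hg n
    rw [← integral_sub (hint n hf) (hint n hg)]
    refine (norm_integral_le_integral_norm _).trans (le_of_eq ?_)
    congr 1; ext s
    rw [← mul_sub, norm_mul, norm_fourier_apply, one_mul]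
  -- The coefficients depend on the density with modulus at most the `L¹` distance, uniformly in
  -- `n`, so decay to zero is an `L¹`-closed condition.
  have approx : ∀ {f : 𝕋 → ℂ}, Integrable f ν →
      (∀ ε > 0, ∃ g : 𝕋 → ℂ, Integrable g ν ∧ ∫ s, ‖f s - g s‖ ∂ν ≤ ε ∧
        Tendsto (fun n : ℤ => ∫ s, (fourier n s : ℂ) * g s ∂ν) cofinite (𝓝 0)) →
      Tendsto (fun n : ℤ => ∫ s, (fourier n s : ℂ) * f s ∂ν) cofinite (𝓝 0) := by
    intro f hf hg
    rw [Metric.tendsto_nhds]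
    intro ε hε
    obtain ⟨g, hgi, hfg, hgt⟩ := hg (ε / 2) (half_pos hε)
    filter_upwards [Metric.tendsto_nhds.1 hgt (ε / 2) (half_pos hε)] with n hn
    rw [dist_zero_right] at hn ⊢
    have h1 := norm_sub_norm_le (∫ s, (fourier n s : ℂ) * f s ∂ν) (∫ s, (fourier n s : ℂ) * g s ∂ν)
    have h2 := key hf hgi n
    linarith
  have hcont : ∀ f : C(𝕋, ℂ), Integrable f ν := fun f =>
    (BoundedContinuousFunction.mkOfCompact f).integrable ν
  have hspan : ∀ f ∈ Submodule.span ℂ (Set.range (@fourier (1 : ℝ))),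
      Tendsto (fun n : ℤ => ∫ s, (fourier n s : ℂ) * f s ∂ν) cofinite (𝓝 0) := by
    intro f hf
    induction hf using Submodule.span_induction with
    | mem f hf =>
      obtain ⟨m, rfl⟩ := hf
      -- Multiplying by a character only shifts the coefficient sequence, which keeps the limit
      -- along `cofinite`.
      have h1 : Tendsto (fun n : ℤ => n + m) cofinite cofinite :=
        (add_left_injective m).tendsto_cofinite
      refine (hν.2.comp h1).congr fun n => ?_
      simp only [Function.comp_apply, fourier_add]
    | zero => simp
    | add f g _ _ hf hg =>
      have hfg := hf.add hg
      rw [add_zero] at hfg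
      refine hfg.congr fun n => ?_
      rw [← integral_add (hint n (hcont f)) (hint n (hcont g))]
      simp only [ContinuousMap.add_apply, mul_add]
    | smul c f _ hf =>
      have hcf := hf.const_mul c
      rw [mul_zero] at hcf
      refine hcf.congr fun n => ?_
      rw [← integral_const_mul]
      simp only [ContinuousMap.smul_apply, smul_eq_mul]
      congr 1; ext s; ring
  -- Two approximations: `L¹` by bounded continuous functions, then uniformly by trigonometric
  -- polynomials. The `+ 1` in the second tolerance covers `ν = 0`.
  refine approx hh fun ε hε => ?_
  obtain ⟨g, hg, hgi⟩ := hh.exists_boundedContinuous_integral_sub_le hε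
  refine ⟨g, hgi, hg, approx hgi fun ε hε => ?_⟩
  have hδ : 0 < ε / (ν.real Set.univ + 1) := by positivity
  have hmem : g.toContinuousMap ∈
      (Submodule.span ℂ (Set.range (@fourier (1 : ℝ)))).topologicalClosure := by
    rw [span_fourier_closure_eq_top]; trivial
  obtain ⟨p, hp, hdist⟩ := Metric.mem_closure_iff.1 hmem _ hδ
  refine ⟨p, hcont p, ?_, hspan p hp⟩
  calc ∫ s, ‖g s - p s‖ ∂ν ≤ ∫ _, ε / (ν.real Set.univ + 1) ∂ν := by
        refine integral_mono ((hgi.sub (hcont p)).norm) (integrable_const _) fun s => ?_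
        have := (ContinuousMap.dist_apply_le_dist s).trans hdist.le
        rwa [dist_eq_norm] at this
    _ = ν.real Set.univ * (ε / (ν.real Set.univ + 1)) := by simp
    _ ≤ ε := by
        rw [mul_div_assoc', div_le_iff₀ (by positivity)]
        nlinarith [measureReal_nonneg (μ := ν) (s := Set.univ)]

end Circle

/-! ### Disintegrations over the first coordinate: uniqueness and existence. -/

section Disintegration

/-- On a measure concentrated on `{t} × X`, pulling back along the inclusion and pushing forward
along the projection agree. The pushforward form is the one used for integration and uniqueness. -/
theorem fiberMeasure_eq_map_snd {X : Type*} [MeasurableSpace X] [MeasurableSingletonClass X]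
    {ν : Measure (X × X)} {t : X} (h : ν {x | x.1 ≠ t} = 0) :
    fiberMeasure ν t = ν.map Prod.snd := by
  ext B hB
  rw [fiberMeasure, (measurableEmbedding_prodMk_left t).comap_apply,
    Measure.map_apply measurable_snd hB]
  refine measure_congr ?_
  have h' : ∀ᵐ x ∂ν, x.1 = t := h
  filter_upwards [h'] with x hx
  refine propext ⟨?_, fun hxB => ⟨x.2, hxB, Prod.ext hx.symm rfl⟩⟩
  rintro ⟨y, hy, rfl⟩
  exact hy

variable {Y Z : Type*} [MeasurableSpace Y] [MeasurableSpace Z]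

/-- The second marginals of the members of a disintegration over the first coordinate are
determined almost everywhere. -/
theorem IsDisintegration.ae_map_snd_eq [MeasurableSpace.CountablyGenerated Z]
    {η : Measure (Y × Z)} [IsFiniteMeasure η] {μ : Measure Y} [SigmaFinite μ]
    {κ κ' : Y → Measure (Y × Z)} (hκ : IsDisintegration η Prod.fst μ κ)
    (hκ' : IsDisintegration η Prod.fst μ κ') :
    ∀ᵐ t ∂μ, IsFiniteMeasure ((κ t).map Prod.snd) ∧
      (κ t).map Prod.snd = (κ' t).map Prod.snd := by
  have hmeas : ∀ {κ : Y → Measure (Y × Z)}, IsDisintegration η Prod.fst μ κ → ∀ B : Set Z,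
      MeasurableSet B → Measurable fun t => (κ t).map Prod.snd B := by
    intro κ hκ B hB
    convert hκ.measurable ((Prod.snd ⁻¹' B).indicator 1)
      (measurable_one.indicator (measurable_snd hB)) using 2 with t
    rw [Measure.map_apply measurable_snd hB, lintegral_indicator_one (measurable_snd hB)]
  -- Testing on rectangles: concentration on the fibre turns the factor `A` into a restriction on
  -- `t`, so the right-hand side does not depend on `κ`.
  have hint : ∀ {κ : Y → Measure (Y × Z)}, IsDisintegration η Prod.fst μ κ → ∀ B : Set Z,
      MeasurableSet B → ∀ A : Set Y, MeasurableSet A →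
        ∫⁻ t in A, (κ t).map Prod.snd B ∂μ = η (A ×ˢ B) := by
    intro κ hκ B hB A hA
    rw [← lintegral_indicator_one (hA.prod hB),
      hκ.lintegral_eq _ (measurable_one.indicator (hA.prod hB)), ← lintegral_indicator hA]
    refine lintegral_congr_ae ?_
    filter_upwards [hκ.concentrated] with t ht
    rw [lintegral_indicator_one (hA.prod hB)]
    have ht' : ∀ᵐ x ∂(κ t), x.1 = t := ht
    by_cases htA : t ∈ A
    · rw [Set.indicator_of_mem htA, Measure.map_apply measurable_snd hB]
      refine measure_congr ?_
      filter_upwards [ht'] with x hx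
      exact propext ⟨fun hxB => ⟨by rwa [hx], hxB⟩, fun hxB => hxB.2⟩
    · rw [Set.indicator_of_notMem htA]
      symm
      refine measure_mono_null (fun x hx => ?_) ht
      rintro rfl
      exact htA hx.1
  have heq : ∀ B : Set Z, MeasurableSet B →
      ∀ᵐ t ∂μ, (κ t).map Prod.snd B = (κ' t).map Prod.snd B := fun B hB =>
    ae_eq_of_forall_setLIntegral_eq_of_sigmaFinite (hmeas hκ B hB) (hmeas hκ' B hB)
      fun A hA _ => by rw [hint hκ B hB A hA, hint hκ' B hB A hA]
  have hfin : ∀ᵐ t ∂μ, (κ t).map Prod.snd Set.univ < ∞ := by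
    refine ae_lt_top (hmeas hκ _ .univ) ?_
    rw [← setLIntegral_univ, hint hκ _ .univ _ .univ]
    exact measure_ne_top _ _
  -- A countable generating algebra is a π-system, so one exceptional null set of `t` serves for all
  -- measurable `B`.
  obtain ⟨b, hbc, hb⟩ : ∃ b : Set (Set Z), b.Countable ∧ ‹MeasurableSpace Z› = .generateFrom b :=
    MeasurableSpace.CountablyGenerated.isCountablyGenerated
  have hset : IsSetAlgebra (generateSetAlgebra b) := isSetAlgebra_generateSetAlgebra
  have hgen : ‹MeasurableSpace Z› = .generateFrom (generateSetAlgebra b) := by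
    rw [generateFrom_generateSetAlgebra_eq]; exact hb
  have hall : ∀ᵐ t ∂μ, ∀ B ∈ generateSetAlgebra b,
      (κ t).map Prod.snd B = (κ' t).map Prod.snd B := by
    rw [ae_ball_iff (countable_generateSetAlgebra hbc)]
    intro B hB
    refine heq B ?_
    rw [hgen]; exact MeasurableSpace.measurableSet_generateFrom hB
  filter_upwards [hfin, hall, heq _ .univ] with t h1 h2 h3
  have hf : IsFiniteMeasure ((κ t).map Prod.snd) := ⟨h1⟩
  exact ⟨hf, ext_of_generate_finite _ hgen hset.isSetRing.isSetSemiring.isPiSystem h2 h3⟩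

/-- A measure with a density with respect to an integral of finite measures concentrated on the
fibres is disintegrated by the measures with the same density. -/
theorem isDisintegration_withDensity {R : Type*} [MeasurableSpace R] [MeasurableSingletonClass Y]
    (μ : Measure Y) (ν : Measure R) [IsFiniteMeasure ν] {φ : Y → R → Z}
    (hφ : Measurable fun p : Y × R => φ p.1 p.2) {g : Y × Z → NNReal} (hg : Measurable g) :
    IsDisintegration
      (((μ.prod ν).map fun p : Y × R => (p.1, φ p.1 p.2)).withDensity fun z => (g z : ℝ≥0∞))
      Prod.fst μ
      (fun t => (ν.map fun r => (t, φ t r)).withDensity fun z => (g z : ℝ≥0∞)) := by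
  have hg' : Measurable fun z => (g z : ℝ≥0∞) := hg.coe_nnreal_ennreal
  have hΦ : Measurable fun p : Y × R => (p.1, φ p.1 p.2) := measurable_fst.prodMk hφ
  have hφt : ∀ t, Measurable fun r => (t, φ t r) := fun t => hΦ.comp measurable_prodMk_left
  have hformula : ∀ f : Y × Z → ℝ≥0∞, Measurable f → ∀ t,
      ∫⁻ x, f x ∂((ν.map fun r => (t, φ t r)).withDensity fun z => (g z : ℝ≥0∞)) =
        ∫⁻ r, g (t, φ t r) * f (t, φ t r) ∂ν := by
    intro f hf t
    rw [lintegral_withDensity_eq_lintegral_mul _ hg' hf, lintegral_map (hg'.mul hf) (hφt t)]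
    rfl
  have hjoint : ∀ f : Y × Z → ℝ≥0∞, Measurable f →
      Measurable fun p : Y × R => (g (p.1, φ p.1 p.2) : ℝ≥0∞) * f (p.1, φ p.1 p.2) :=
    fun f hf => (hg'.comp hΦ).mul (hf.comp hΦ)
  refine ⟨fun t => ?_, ae_of_all _ fun t => ?_, fun f hf => ?_, fun f hf => ?_⟩
  · exact SigmaFinite.withDensity g
  · refine withDensity_absolutelyContinuous _ _ ?_
    have hs : MeasurableSet {x : Y × Z | x.1 ≠ t} :=
      (measurable_fst (measurableSet_singleton t)).compl
    rw [Measure.map_apply (hφt t) hs]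
    simp
  · simp_rw [hformula f hf]
    exact (hjoint f hf).lintegral_prod_right'
  · simp_rw [hformula f hf]
    rw [lintegral_withDensity_eq_lintegral_mul _ hg' hf, lintegral_map (hg'.mul hf) hΦ]
    exact lintegral_prod _ (hjoint f hf).aemeasurable

end Disintegration

/-! ### Fibres of a measure dominated by a sheared product. -/

section Circle

local notation "𝕋" => UnitAddCircle
local notation "haar" => (AddCircle.haarAddCircle : Measure UnitAddCircle)

/-- An absolutely continuous image of a mixing measure under a reflection is mixing. -/
theorem IsMixingMeasure.map_snd_withDensity {ν : Measure 𝕋} (hν : IsMixingMeasure ν) (t : 𝕋)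
    {g : 𝕋 × 𝕋 → NNReal} (hg : Measurable g)
    (hfin : IsFiniteMeasure
      (((ν.map fun r => (t, t - r)).withDensity fun z => (g z : ℝ≥0∞)).map Prod.snd)) :
    IsMixingMeasure
      (((ν.map fun r => (t, t - r)).withDensity fun z => (g z : ℝ≥0∞)).map Prod.snd) := by
  refine ⟨hfin, ?_⟩
  have hmap : Measurable fun r : 𝕋 => (t, t - r) := by fun_prop
  have hg' : Measurable fun z => (g z : ℝ≥0∞) := hg.coe_nnreal_ennreal
  have hint : Integrable (fun r => ((g (t, t - r) : ℝ) : ℂ)) ν := by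
    refine ⟨(Complex.measurable_ofReal.comp
      (hg.comp hmap).coe_nnreal_real).aestronglyMeasurable, ?_⟩
    have h1 := hfin.measure_univ_lt_top
    rw [Measure.map_apply measurable_snd .univ, Set.preimage_univ, withDensity_apply _ .univ,
      setLIntegral_univ, lintegral_map hg' hmap] at h1
    simpa [HasFiniteIntegral, enorm_eq_nnnorm] using h1
  -- The reflection `r ↦ t - r` replaces `n` by `-n` and contributes the phase `fourier n t`, which
  -- disappears on taking norms.
  have h := (hν.tendsto_integral_fourier_mul hint).comp (neg_injective (G := ℤ)).tendsto_cofinite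
  rw [tendsto_zero_iff_norm_tendsto_zero] at h ⊢
  refine h.congr fun n => ?_
  rw [integral_map (by fun_prop) (by fun_prop),
    integral_withDensity_eq_integral_smul hg, integral_map (by fun_prop) (by fun_prop)]
  have : ∀ r, g (t, t - r) • (fourier n (t - r) : ℂ) =
      fourier n t * (fourier (-n) r * ((g (t, t - r) : ℝ) : ℂ)) := by
    intro r
    rw [fourier_sub_apply, NNReal.smul_def, Complex.real_smul]
    ring
  simp_rw [this]
  rw [integral_const_mul, norm_mul, norm_fourier_apply, one_mul]
  rfl

/-- The Radon–Nikodym density of `η` reduces existence to the explicit sheared product. Uniqueness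
of second marginals then identifies almost every fibre of any disintegration with an explicit one,
and finiteness of `η` makes almost every fibre finite. -/
theorem exists_disintegration_and_ae_isMixingMeasure {η : Measure (𝕋 × 𝕋)} [IsFiniteMeasure η]
    {ν : Measure 𝕋} (hν : IsMixingMeasure ν)
    (hη : η ≪ ((haar).prod ν).map fun p : 𝕋 × 𝕋 => (p.1, p.1 - p.2)) :
    (∃ κ : 𝕋 → Measure (𝕋 × 𝕋), IsDisintegration η Prod.fst haar κ) ∧
    ∀ κ : 𝕋 → Measure (𝕋 × 𝕋), IsDisintegration η Prod.fst haar κ →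
      ∀ᵐ t ∂haar, IsMixingMeasure (fiberMeasure (κ t) t) := by
  have := hν.1
  set μ := ((haar).prod ν).map fun p : 𝕋 × 𝕋 => (p.1, p.1 - p.2) with hμ
  -- The density is finite almost everywhere; truncating it to `NNReal` values makes every fibre
  -- measure σ-finite, not merely almost every one.
  set g : 𝕋 × 𝕋 → NNReal := fun z => (η.rnDeriv μ z).toNNReal with hgdef
  have hg : Measurable g := (Measure.measurable_rnDeriv η μ).ennreal_toNNReal
  have hηg : η = μ.withDensity fun z => (g z : ℝ≥0∞) := by
    conv_lhs => rw [← Measure.withDensity_rnDeriv_eq η μ hη]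
    refine withDensity_congr_ae ?_
    filter_upwards [Measure.rnDeriv_lt_top η μ] with z hz
    exact (ENNReal.coe_toNNReal hz.ne).symm
  have hdis := isDisintegration_withDensity haar ν (φ := fun t r : 𝕋 => t - r)
    (by fun_prop) hg
  rw [← hμ, ← hηg] at hdis
  refine ⟨⟨_, hdis⟩, fun κ hκ => ?_⟩
  filter_upwards [hκ.ae_map_snd_eq hdis, hκ.concentrated] with t ht hc
  rw [fiberMeasure_eq_map_snd hc]
  have hfin := ht.1
  rw [ht.2] at hfin ⊢
  exact hν.map_snd_withDensity t hg hfin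

end Circle

/-! ### Vectors and null sets in direct integrals. -/

section DirectIntegral

variable {Z : Type*} [MeasurableSpace Z] {F : MeasurableHilbertField Z} {ρ : Measure Z}
  {K : Type*} [NormedAddCommGroup K] [InnerProductSpace ℂ K]

namespace DirectIntegralIso

variable (U : DirectIntegralIso F ρ K)

theorem map_sub (ζ ζ' : K) :
    ∀ᵐ z ∂ρ, U.toSection (ζ - ζ') z = U.toSection ζ z - U.toSection ζ' z := by
  filter_upwards [U.map_add (ζ - ζ') ζ'] with z hz
  rw [sub_add_cancel] at hz
  rw [hz, add_sub_cancel_right]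

/-- The direct integral isomorphism preserves inner products. -/
theorem inner_eq_integral (ζ ζ' : K) :
    ⟪ζ, ζ'⟫_ℂ = ∫ z, ⟪U.toSection ζ z, U.toSection ζ' z⟫_ℂ ∂ρ := by
  have hI : ∀ ζ : K, Integrable (fun z => ((‖U.toSection ζ z‖ : ℂ)) ^ 2) ρ := fun ζ => by
    simpa using (U.isL2Section ζ).integrable.ofReal (𝕜 := ℂ)
  have hn : ∀ ζ : K, (‖ζ‖ : ℂ) ^ 2 = ∫ z, ((‖U.toSection ζ z‖ : ℂ)) ^ 2 ∂ρ := fun ζ => by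
    rw [← Complex.ofReal_pow, U.norm_sq, ← integral_complex_ofReal]
    simp
  rw [inner_eq_sum_norm_sq_div_four]
  simp only [Complex.coe_algebraMap, RCLike.I_to_complex]
  have hD : ∀ ζ₁ ζ₂ : K, Integrable
      (fun z => ((‖U.toSection ζ₁ z‖ : ℂ)) ^ 2 - ((‖U.toSection ζ₂ z‖ : ℂ)) ^ 2) ρ :=
    fun ζ₁ ζ₂ => (hI ζ₁).sub (hI ζ₂)
  rw [hn, hn, hn, hn, ← integral_sub (hI _) (hI _), ← integral_sub (hI _) (hI _),
    ← integral_mul_const, ← integral_add (hD _ _) ((hD _ _).mul_const _), ← integral_div]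
  refine integral_congr_ae ?_
  filter_upwards [U.map_add ζ ζ', U.map_sub ζ ζ', U.map_add ζ (Complex.I • ζ'),
    U.map_sub ζ (Complex.I • ζ'), U.map_smul Complex.I ζ'] with z h1 h2 h3 h4 h5
  rw [inner_eq_sum_norm_sq_div_four, h1, h2, h3, h4, h5]
  simp

/-- The vectors which are represented by sections vanishing on a given set. -/
def vanishingOn (E : Set Z) : Submodule ℂ K where
  carrier := {ζ | ∀ᵐ z ∂ρ, z ∈ E → U.toSection ζ z = 0}
  add_mem' {ζ ζ'} h h' := by
    filter_upwards [h, h', U.map_add ζ ζ'] with z hz hz' hs hE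
    rw [hs, hz hE, hz' hE, add_zero]
  zero_mem' := by
    filter_upwards [U.map_smul 0 0] with z hz _
    simpa using hz
  smul_mem' c ζ h := by
    filter_upwards [h, U.map_smul c ζ] with z hz hs hE
    rw [hs, hz hE, smul_zero]

theorem mem_vanishingOn {E : Set Z} {ζ : K} :
    ζ ∈ U.vanishingOn E ↔ ∀ᵐ z ∂ρ, z ∈ E → U.toSection ζ z = 0 := Iff.rfl

/-- The mass of `ζ` on `E` is at most `‖ζ - ζ'‖²` for every `ζ'` vanishing on `E`, hence is zero for
limits of such `ζ'`. -/
theorem isClosed_vanishingOn {E : Set Z} (hE : MeasurableSet E) :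
    IsClosed (U.vanishingOn E : Set K) := by
  refine isClosed_of_closure_subset fun ζ hζ => ?_
  have hle : ∀ ζ' ∈ U.vanishingOn E, ∫ z in E, ‖U.toSection ζ z‖ ^ 2 ∂ρ ≤ ‖ζ - ζ'‖ ^ 2 := by
    intro ζ' hζ'
    rw [U.norm_sq]
    calc ∫ z in E, ‖U.toSection ζ z‖ ^ 2 ∂ρ = ∫ z in E, ‖U.toSection (ζ - ζ') z‖ ^ 2 ∂ρ := by
          refine setIntegral_congr_ae hE ?_
          filter_upwards [U.mem_vanishingOn.1 hζ', U.map_sub ζ ζ'] with z h1 h2 hz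
          rw [h2, h1 hz, sub_zero]
      _ ≤ ∫ z, ‖U.toSection (ζ - ζ') z‖ ^ 2 ∂ρ :=
          setIntegral_le_integral (U.isL2Section _).integrable
            (ae_of_all _ fun z => by positivity)
  have h0 : ∫ z in E, ‖U.toSection ζ z‖ ^ 2 ∂ρ ≤ 0 := by
    obtain ⟨s, hs, hlim⟩ := mem_closure_iff_seq_limit.1 hζ
    have ht : Tendsto (fun k => ‖ζ - s k‖ ^ 2) atTop (𝓝 0) := by
      have := ((tendsto_const_nhds (x := ζ)).sub hlim).norm.pow 2
      simpa using this
    exact ge_of_tendsto' ht fun k => hle _ (hs k)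
  have h1 : ∫ z in E, ‖U.toSection ζ z‖ ^ 2 ∂ρ = 0 :=
    le_antisymm h0 (integral_nonneg fun z => by positivity)
  rw [setIntegral_eq_zero_iff_of_nonneg_ae (ae_of_all _ fun z => by positivity)
    (U.isL2Section ζ).integrable.integrableOn] at h1
  have h2 := (ae_restrict_iff' hE).1 h1
  refine U.mem_vanishingOn.2 ?_
  filter_upwards [h2] with z hz hzE
  simpa using hz hzE

end DirectIntegralIso

theorem MeasurableHilbertField.exists_fund_ne_zero (z : Z) [Nontrivial (F.fiber z)] :
    ∃ i, F.fund i z ≠ 0 := by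
  by_contra! h
  have htot := F.total z
  have hr : Submodule.span ℂ (Set.range fun i => F.fund i z) = ⊥ := by
    rw [Submodule.span_eq_bot]
    rintro _ ⟨i, rfl⟩
    exact h i
  rw [hr, (Submodule.closed_of_finiteDimensional (⊥ : Submodule ℂ (F.fiber z))
    ).submodule_topologicalClosure_eq] at htot
  exact bot_ne_top htot

/-- In a direct integral with non-zero fibres, there are countably many vectors whose sections
have no common zeros, up to null sets. -/
theorem DirectIntegralIso.exists_seq_of_nontrivial [IsFiniteMeasure ρ]
    (U : DirectIntegralIso F ρ K) (hF : ∀ᵐ z ∂ρ, Nontrivial (F.fiber z)) :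
    ∃ ζ : ℕ → K, ∀ E : Set Z, (∀ i, ζ i ∈ U.vanishingOn E) → ρ E = 0 := by
  have hnorm : ∀ i, Measurable fun z => ‖F.fund i z‖ := by
    intro i
    have : (fun z => ‖F.fund i z‖) = fun z => √(RCLike.re ⟪F.fund i z, F.fund i z⟫_ℂ) := by
      ext z; rw [norm_eq_sqrt_re_inner (𝕜 := ℂ)]
    rw [this]
    exact (Complex.measurable_re.comp (F.measurable_inner i i)).sqrt
  -- The factor `(1 + ‖·‖)⁻¹` bounds the section by one, so it is square-integrable for the finite
  -- measure `ρ`, and it creates no new zeros.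
  have hL2 : ∀ i, F.IsL2Section ρ
      (fun z => ((1 + ‖F.fund i z‖ : ℝ) : ℂ)⁻¹ • F.fund i z) := by
    intro i
    constructor
    · intro j
      simp_rw [inner_smul_right]
      exact ((Complex.measurable_ofReal.comp ((hnorm i).const_add 1)).inv.mul
        (F.measurable_inner j i)).aemeasurable
    · have heq : ∀ z, ‖((1 + ‖F.fund i z‖ : ℝ) : ℂ)⁻¹ • F.fund i z‖ =
          (1 + ‖F.fund i z‖)⁻¹ * ‖F.fund i z‖ := by
        intro z
        rw [norm_smul, norm_inv, Complex.norm_real, Real.norm_of_nonneg (by positivity)]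
      simp_rw [heq]
      refine Integrable.of_bound (C := 1) (by have := hnorm i; fun_prop) (ae_of_all _ fun z => ?_)
      have h1 : (1 + ‖F.fund i z‖)⁻¹ * ‖F.fund i z‖ ≤ 1 := by
        rw [inv_mul_le_iff₀ (by positivity)]; linarith
      rw [Real.norm_of_nonneg (by positivity)]
      exact pow_le_one₀ (by positivity) h1
  choose ζ hζ using fun i => U.surjective _ (hL2 i)
  refine ⟨ζ, fun E hE => ?_⟩
  have h : ∀ᵐ z ∂ρ, z ∉ E := by
    filter_upwards [hF, ae_all_iff.2 hζ, ae_all_iff.2 fun i => U.mem_vanishingOn.1 (hE i)]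
      with z h1 h2 h3 hz
    obtain ⟨i, hi⟩ := F.exists_fund_ne_zero z
    have := h3 i hz
    rw [h2 i] at this
    rcases smul_eq_zero.1 this with h | h
    · rw [inv_eq_zero, Complex.ofReal_eq_zero] at h
      have := norm_nonneg (F.fund i z)
      linarith
    · exact hi h
  simpa [ae_iff] using h

end DirectIntegral

/-- Each term of an approximating sequence involves finitely many generators. This extracts
countably many elements of `N` from a possibly uncountable spanning family. -/
theorem exists_countable_mem_closure_span {ι K : Type*} [NormedAddCommGroup K] [NormedSpace ℂ K]
    {g : ι → K} {ζ : K} (hζ : ζ ∈ (Submodule.span ℂ (Set.range g)).topologicalClosure) :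
    ∃ C : Set ι, C.Countable ∧ ζ ∈ (Submodule.span ℂ (g '' C)).topologicalClosure := by
  obtain ⟨s, hs, hlim⟩ := mem_closure_iff_seq_limit.1 hζ
  choose c hc using fun k => Finsupp.mem_span_range_iff_exists_finsupp.1 (hs k)
  refine ⟨⋃ k, (c k).support, Set.countable_iUnion fun k => (c k).support.countable_toSet,
    mem_closure_of_tendsto hlim (Eventually.of_forall fun k => ?_)⟩
  rw [← hc k]
  exact Submodule.sum_mem _ fun i hi => Submodule.smul_mem _ _
    (Submodule.subset_span ⟨i, Set.mem_iUnion.2 ⟨k, hi⟩, rfl⟩)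

/-! ### Matrix entries and Fourier coefficients in the crossed product. -/

section Crossed

variable {H : Type*} [NormedAddCommGroup H] [InnerProductSpace ℂ H] [CompleteSpace H]
  {N : VonNeumannAlgebra H} (α : IntAction N)

theorem IntAction.at_zero : α.at 0 = 1 := map_one α

/-- The canonical embedding of `N` into `N ⋊ ℤ`. -/
def piElem (x : Elem N) : Elem (crossedProduct α) :=
  ⟨piRep α x, subset_vnGenerate _ (Or.inl ⟨x, rfl⟩)⟩

theorem piElem_add (x y : Elem N) : piElem α (x + y) = piElem α x + piElem α y := by
  apply Subtype.ext
  ext ξ n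
  change ((α.at (-n) (x + y) : Elem N) : H →L[ℂ] H) (ξ n) = _
  rw [_root_.map_add]; rfl

theorem piElem_smul (c : ℂ) (x : Elem N) : piElem α (c • x) = c • piElem α x := by
  apply Subtype.ext
  ext ξ n
  change ((α.at (-n) (c • x) : Elem N) : H →L[ℂ] H) (ξ n) = _
  rw [_root_.map_smul]; rfl

theorem piElem_one : piElem α 1 = 1 := by
  apply Subtype.ext
  ext ξ n
  change ((α.at (-n) 1 : Elem N) : H →L[ℂ] H) (ξ n) = _
  rw [_root_.map_one]; rfl

theorem star_piRep (x : Elem N) : star (piRep α x) = piRep α (star x) := by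
  rw [ContinuousLinearMap.star_eq_adjoint]
  symm
  rw [ContinuousLinearMap.eq_adjoint_iff]
  intro ξ ζ
  rw [lp.inner_eq_tsum, lp.inner_eq_tsum]
  refine tsum_congr fun n => ?_
  rw [piRep_apply, piRep_apply, map_star]
  exact ContinuousLinearMap.adjoint_inner_left _ _ _

theorem coe_canonicalUnitary_zpow (m : ℤ) :
    (((canonicalUnitary α ^ m : unitary (Elem (crossedProduct α))) : Elem (crossedProduct α)) :
      EllTwo H →L[ℂ] EllTwo H) = shiftOp H m := by
  induction m with
  | zero => rw [zpow_zero]; exact shiftOp_zero.symm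
  | succ m ih => rw [zpow_add_one, ← shiftOp_mul, ← ih]; rfl
  | pred m ih =>
    rw [zpow_sub_one, sub_eq_add_neg, ← shiftOp_mul, ← ih, ← star_shiftOp]; rfl

omit [CompleteSpace H] in
theorem deltaZero_apply (v : H) (n : ℤ) : deltaZero H v n = if n = 0 then v else 0 := by
  change (lp.single 2 (0 : ℤ) v : EllTwo H) n = _
  rw [lp.single_apply]
  by_cases hn : n = 0
  · subst hn; simp
  · simp [hn]

omit [CompleteSpace H] in
theorem norm_deltaZero (v : H) : ‖deltaZero H v‖ = ‖v‖ :=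
  lp.norm_single (E := fun _ : ℤ => H) (by norm_num) (0 : ℤ) v

theorem entryZero_apply (T : EllTwo H →L[ℂ] EllTwo H) (v : H) :
    entryZero H T v = T (deltaZero H v) 0 := adjoint_deltaZero _

theorem crossedTrace_apply (τ : PositiveFunctional N) (T : Elem (crossedProduct α)) :
    crossedTrace τ α T = τ (condExpN α T) := rfl

/-- The covariance relation gives `u_m x u_n = α_m(x) u_{m+n}`, and the expectation keeps only the
coefficient of `u_0`. -/
theorem condExpN_piElem_conj (x : Elem N) (m n : ℤ) :
    condExpN α (star (piElem α x) *
      (((canonicalUnitary α ^ m : unitary (Elem (crossedProduct α))) : Elem (crossedProduct α)) *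
        piElem α x *
        ((canonicalUnitary α ^ n : unitary (Elem (crossedProduct α))) :
          Elem (crossedProduct α)))) = if m + n = 0 then star x * α.at m x else 0 := by
  apply Subtype.ext
  ext v
  change entryZero H (star (piRep α x) *
    ((((canonicalUnitary α ^ m : unitary (Elem (crossedProduct α))) : Elem (crossedProduct α)) :
      EllTwo H →L[ℂ] EllTwo H) * piRep α x *
      (((canonicalUnitary α ^ n : unitary (Elem (crossedProduct α))) : Elem (crossedProduct α)) :
      EllTwo H →L[ℂ] EllTwo H))) v = _
  rw [coe_canonicalUnitary_zpow, coe_canonicalUnitary_zpow, star_piRep, entryZero_apply]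
  change ((α.at (-0) (star x) : Elem N) : H →L[ℂ] H)
    (((α.at (-(0 - m)) x : Elem N) : H →L[ℂ] H) (deltaZero H v (0 - m - n))) = _
  rw [deltaZero_apply, neg_zero, α.at_zero, zero_sub, neg_neg]
  have : (-m - n = 0) ↔ m + n = 0 := by omega
  by_cases h : m + n = 0
  · rw [if_pos h, if_pos (this.2 h)]; rfl
  · rw [if_neg h, if_neg (fun h' => h (this.1 h'))]; simp

/-- The Fourier coefficients in the crossed product are the entries of its matrices. -/
theorem apply_deltaZero_apply (y : Elem (crossedProduct α)) (v : H) (k : ℤ) :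
    (y : EllTwo H →L[ℂ] EllTwo H) (deltaZero H v) k =
      ((condExpN α (((canonicalUnitary α ^ (-k) : unitary (Elem (crossedProduct α))) :
        Elem (crossedProduct α)) * y) : Elem N) : H →L[ℂ] H) v := by
  change _ = entryZero H ((((canonicalUnitary α ^ (-k) : unitary (Elem (crossedProduct α))) :
    Elem (crossedProduct α)) : EllTwo H →L[ℂ] EllTwo H) * y) v
  rw [coe_canonicalUnitary_zpow, entryZero_apply, mul_apply_eq_comp, shiftOp_apply,
    zero_sub, neg_neg]

/-- The vector `u_k w δ₀` is concentrated at `k`. -/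
theorem zpow_mul_piElem_deltaZero (k : ℤ) (w : Elem N) (v : H) :
    ((((canonicalUnitary α ^ k : unitary (Elem (crossedProduct α))) : Elem (crossedProduct α)) *
      piElem α w : Elem (crossedProduct α)) : EllTwo H →L[ℂ] EllTwo H) (deltaZero H v) =
      lp.single 2 k ((w : H →L[ℂ] H) v) := by
  change ((((canonicalUnitary α ^ k : unitary (Elem (crossedProduct α))) :
    Elem (crossedProduct α)) : EllTwo H →L[ℂ] EllTwo H) * piRep α w) _ = _
  rw [coe_canonicalUnitary_zpow]
  ext n
  change ((α.at (-(n - k)) w : Elem N) : H →L[ℂ] H) (deltaZero H v (n - k)) = _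
  rw [deltaZero_apply, lp.single_apply]
  by_cases h : n = k
  · subst h; simp [α.at_zero]
  · simp [sub_eq_zero, h]

omit [InnerProductSpace ℂ H] [CompleteSpace H] in
theorem norm_sub_sum_single_le (f : EllTwo H) (s : Finset ℤ) :
    ‖f - ∑ k ∈ s, lp.single 2 k (f k)‖ ≤ ‖f‖ := by
  have h := lp.norm_compl_sum_single (p := 2) (by norm_num) f s
  have h2 : (0 : ℝ) ≤ ∑ i ∈ s, ‖f i‖ ^ (2 : ℝ≥0∞).toReal :=
    Finset.sum_nonneg fun i _ => by positivity
  refine le_of_sq_le_sq ?_ (norm_nonneg _)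
  norm_num at h h2 ⊢
  linarith

end Crossed

/-! ### Density of the span of the vectors `u_k w` in `L²`. -/

section Density

variable {H : Type*} [NormedAddCommGroup H] [InnerProductSpace ℂ H] [CompleteSpace H]
  {N : VonNeumannAlgebra H} (α : IntAction N)

/-- The vector of `L²` given by `u_k w`, where `w ∈ N`. -/
def coeffVec (φ : PositiveFunctional (crossedProduct α)) (p : ℤ × Elem N) : φ.L2 :=
  φ.toL2 (((canonicalUnitary α ^ p.1 : unitary (Elem (crossedProduct α))) :
    Elem (crossedProduct α)) * piElem α p.2)

theorem PositiveFunctional.toL2_add {M : VonNeumannAlgebra H} (φ : PositiveFunctional M)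
    (x y : Elem M) : φ.toL2 (x + y) = φ.toL2 x + φ.toL2 y :=
  UniformSpace.Completion.coe_add _ _

theorem PositiveFunctional.toL2_smul {M : VonNeumannAlgebra H} (φ : PositiveFunctional M)
    (c : ℂ) (x : Elem M) : φ.toL2 (c • x) = c • φ.toL2 x :=
  UniformSpace.Completion.coe_smul c (φ.toPreL2 x)

/-- The canonical map `M → L²(M, φ)` as a linear map. -/
def PositiveFunctional.toL2Lin {M : VonNeumannAlgebra H} (φ : PositiveFunctional M) :
    Elem M →ₗ[ℂ] φ.L2 where
  toFun := φ.toL2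
  map_add' := φ.toL2_add
  map_smul' := φ.toL2_smul

theorem PositiveFunctional.denseRange_toL2 {M : VonNeumannAlgebra H} (φ : PositiveFunctional M) :
    DenseRange φ.toL2 :=
  UniformSpace.Completion.denseRange_coe (α := φ.PreL2)

theorem PositiveFunctional.norm_toL2_sq {M : VonNeumannAlgebra H} (φ : PositiveFunctional M)
    (x : Elem M) : ((‖φ.toL2 x‖ ^ 2 : ℝ) : ℂ) = φ (star x * x) := by
  rw [← φ.inner_toL2, inner_self_eq_norm_sq_to_K]
  simp

/-- Normality of `τ` expresses the squared `L²` norm of `z` through the vectors `z δ₀ v`, so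
dominated strong convergence on the range of `deltaZero` gives `L²` convergence. -/
theorem hasSum_crossedTrace_star_mul_self {τ : PositiveFunctional N}
    {ξ η : ℕ → H} (h : ∀ x : Elem N, HasSum (fun n => ⟪η n, (x : H →L[ℂ] H) (ξ n)⟫_ℂ) (τ x))
    (z : Elem (crossedProduct α)) :
    HasSum (fun n => ⟪(z : EllTwo H →L[ℂ] EllTwo H) (deltaZero H (η n)),
      (z : EllTwo H →L[ℂ] EllTwo H) (deltaZero H (ξ n))⟫_ℂ) (crossedTrace τ α (star z * z)) := by
  rw [crossedTrace_apply]
  convert h (condExpN α (star z * z)) using 2 with n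
  change _ = ⟪η n, (deltaZero H).adjoint ((star (z : EllTwo H →L[ℂ] EllTwo H)) _)⟫_ℂ
  rw [ContinuousLinearMap.adjoint_inner_right, ContinuousLinearMap.star_eq_adjoint,
    ContinuousLinearMap.adjoint_inner_right]
  rfl

/-- The Fourier expansion of an element of the crossed product converges in `L²`. -/
theorem hasSum_coeffVec {τ : PositiveFunctional N} (hτ : τ.IsFaithfulNormalTracialState)
    (y : Elem (crossedProduct α)) :
    HasSum (fun k : ℤ => coeffVec α (crossedTrace τ α) (k, condExpN α
      (((canonicalUnitary α ^ (-k) : unitary (Elem (crossedProduct α))) :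
        Elem (crossedProduct α)) * y))) ((crossedTrace τ α).toL2 y) := by
  obtain ⟨ξ, η, hξ, hη, h⟩ := hτ.normal
  set φ := crossedTrace τ α
  set w : ℤ → Elem N := fun k => condExpN α
      (((canonicalUnitary α ^ (-k) : unitary (Elem (crossedProduct α))) :
        Elem (crossedProduct α)) * y) with hw
  set Y : EllTwo H →L[ℂ] EllTwo H := (y : EllTwo H →L[ℂ] EllTwo H) with hY
  set p : ℤ → Elem (crossedProduct α) := fun k =>
    ((canonicalUnitary α ^ k : unitary (Elem (crossedProduct α))) :
        Elem (crossedProduct α)) * piElem α (w k) with hp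
  set z : Finset ℤ → Elem (crossedProduct α) := fun s => y - ∑ k ∈ s, p k with hz
  have hzδ : ∀ s v, (z s : EllTwo H →L[ℂ] EllTwo H) (deltaZero H v) =
      Y (deltaZero H v) - ∑ k ∈ s, lp.single 2 k (Y (deltaZero H v) k) := by
    intro s v
    simp only [hz, AddSubgroupClass.coe_sub, AddSubmonoidClass.coe_finsetSum,
      sub_apply, sum_apply]
    congr 1
    refine Finset.sum_congr rfl fun k _ => ?_
    rw [hY, apply_deltaZero_apply]
    exact zpow_mul_piElem_deltaZero α k (w k) v
  -- The remainder applied to `δ₀ v` is `Y δ₀ v` with the coordinates in `s` removed. Its norm is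
  -- thus bounded uniformly in `s`, although the operators `z s` need not be bounded uniformly.
  have hbound : ∀ s v, ‖(z s : EllTwo H →L[ℂ] EllTwo H) (deltaZero H v)‖ ≤ ‖Y‖ * ‖v‖ := by
    intro s v
    rw [hzδ]
    refine (norm_sub_sum_single_le _ s).trans ((Y.le_opNorm _).trans ?_)
    rw [norm_deltaZero]
  have hlim : ∀ v, Tendsto (fun s => (z s : EllTwo H →L[ℂ] EllTwo H) (deltaZero H v)) atTop
      (𝓝 0) := by
    intro v
    simp_rw [hzδ]
    have := (lp.hasSum_single (p := 2) (by norm_num) (Y (deltaZero H v))).const_sub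
      (Y (deltaZero H v))
    rwa [sub_self] at this
  have hsum : Tendsto (fun s => φ (star (z s) * z s)) atTop (𝓝 0) := by
    have h1 : ∀ s, φ (star (z s) * z s) = ∑' n,
        ⟪(z s : EllTwo H →L[ℂ] EllTwo H) (deltaZero H (η n)),
          (z s : EllTwo H →L[ℂ] EllTwo H) (deltaZero H (ξ n))⟫_ℂ :=
      fun s => (hasSum_crossedTrace_star_mul_self α h (z s)).tsum_eq.symm
    simp_rw [h1]
    rw [← tsum_zero (α := ℂ) (β := ℕ)]
    refine tendsto_tsum_of_dominated_convergence
      (bound := fun n => ‖Y‖ ^ 2 * (‖η n‖ ^ 2 + ‖ξ n‖ ^ 2)) ((hη.add hξ).mul_left _) ?_ ?_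
    · intro n
      simpa using (hlim (η n)).inner (𝕜 := ℂ) (hlim (ξ n))
    · refine Eventually.of_forall fun s n => (norm_inner_le_norm _ _).trans ?_
      calc _ ≤ (‖Y‖ * ‖η n‖) * (‖Y‖ * ‖ξ n‖) :=
            mul_le_mul (hbound _ _) (hbound _ _) (norm_nonneg _) (by positivity)
        _ = ‖Y‖ ^ 2 * (‖η n‖ * ‖ξ n‖) := by ring
        _ ≤ _ := by
            refine mul_le_mul_of_nonneg_left ?_ (by positivity)
            nlinarith [sq_nonneg (‖η n‖ - ‖ξ n‖), sq_nonneg (‖η n‖), sq_nonneg (‖ξ n‖)]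
  have hnorm : Tendsto (fun s => ‖φ.toL2 (z s)‖ ^ 2) atTop (𝓝 0) := by
    rw [← Complex.ofReal_zero] at hsum
    simp_rw [← φ.norm_toL2_sq] at hsum
    exact (Complex.continuous_re.tendsto _).comp hsum
  have hzL : ∀ s, φ.toL2 (z s) = φ.toL2 y - ∑ k ∈ s, φ.toL2 (p k) := by
    intro s
    change φ.toL2Lin (y - ∑ k ∈ s, p k) = _
    rw [_root_.map_sub, _root_.map_sum]
    rfl
  change Tendsto (fun s => ∑ k ∈ s, φ.toL2 (p k)) atTop (𝓝 (φ.toL2 y))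
  rw [tendsto_iff_norm_sub_tendsto_zero]
  have := hnorm.sqrt
  rw [Real.sqrt_zero] at this
  refine this.congr fun s => ?_
  rw [Real.sqrt_sq (norm_nonneg _), hzL, norm_sub_rev]

theorem topologicalClosure_span_coeffVec {τ : PositiveFunctional N}
    (hτ : τ.IsFaithfulNormalTracialState) :
    (Submodule.span ℂ (Set.range (coeffVec α (crossedTrace τ α)))).topologicalClosure = ⊤ := by
  rw [eq_top_iff]
  intro ζ _
  have : closure (Set.range (crossedTrace τ α).toL2) ⊆
      ((Submodule.span ℂ (Set.range (coeffVec α (crossedTrace τ α)))).topologicalClosure :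
        Set (crossedTrace τ α).L2) := by
    refine closure_minimal ?_ (Submodule.isClosed_topologicalClosure _)
    rintro _ ⟨y, rfl⟩
    refine mem_closure_of_tendsto (hasSum_coeffVec α hτ y) (Eventually.of_forall fun s => ?_)
    exact Submodule.sum_mem _ fun k _ => Submodule.subset_span ⟨_, rfl⟩
  exact this ((crossedTrace τ α).denseRange_toL2 ζ)

end Density

/-! ### Dominating mixing measures, and measures with antidiagonal coefficients. -/

section Circle

local notation "𝕋" => UnitAddCircle
local notation "haar" => (AddCircle.haarAddCircle : Measure UnitAddCircle)

theorem integral_fourier_haarAddCircle (n : ℤ) :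
    ∫ t, (fourier n t : ℂ) ∂haar = if n = 0 then 1 else 0 := by
  have h := congrFun (fourierCoeff_fourier (T := (1 : ℝ)) 0) (-n)
  rw [Pi.single_apply] at h
  simpa only [fourierCoeff, neg_neg, fourier_zero, smul_eq_mul, mul_one, neg_eq_zero] using h

/-- A sequence of mixing measures is dominated by one mixing measure. -/
theorem exists_isMixingMeasure_forall_absolutelyContinuous {ν : ℕ → Measure 𝕋}
    (hν : ∀ j, IsMixingMeasure (ν j)) :
    ∃ μ : Measure 𝕋, IsMixingMeasure μ ∧ ∀ j, ν j ≪ μ := by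
  have hf : ∀ j, IsFiniteMeasure (ν j) := fun j => (hν j).1
  -- The weights are positive, so each `ν j` is dominated, and small enough that the masses are
  -- summable; the same bound dominates the coefficients uniformly in `n`.
  set c : ℕ → NNReal := fun j => (1 / 2) ^ j / (1 + (ν j Set.univ).toNNReal) with hc
  have hc0 : ∀ j, c j ≠ 0 := fun j => by positivity
  have hcν : ∀ j, c j * (ν j Set.univ).toNNReal ≤ (1 / 2) ^ j := by
    intro j
    rw [hc, div_mul_eq_mul_div, div_le_iff₀ (by positivity)]
    gcongr
    simp
  have hgeom : Summable fun j : ℕ => ((1 / 2 : NNReal)) ^ j :=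
    NNReal.summable_geometric (by norm_num)
  set μ : Measure 𝕋 := Measure.sum fun j => c j • ν j with hμ
  have hfin : IsFiniteMeasure μ := by
    refine ⟨?_⟩
    rw [hμ, Measure.sum_apply _ .univ]
    refine lt_of_le_of_lt (b := ∑' j : ℕ, (((1 / 2 : NNReal) ^ j : NNReal) : ℝ≥0∞)) ?_ ?_
    · refine ENNReal.tsum_le_tsum fun j => ?_
      rw [Measure.smul_apply, ENNReal.smul_def, smul_eq_mul,
        ← ENNReal.coe_toNNReal (measure_ne_top (ν j) Set.univ), ← ENNReal.coe_mul]
      exact ENNReal.coe_le_coe.2 (hcν j)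
    · exact (ENNReal.tsum_coe_ne_top_iff_summable.2 hgeom).lt_top
  refine ⟨μ, ⟨hfin, ?_⟩, fun j => ?_⟩
  · have hint : ∀ n : ℤ, ∫ s, (fourier n s : ℂ) ∂μ =
        ∑' j, c j • ∫ s, (fourier n s : ℂ) ∂(ν j) := by
      intro n
      rw [hμ, integral_sum_measure]
      · simp_rw [integral_smul_nnreal_measure]
      · exact (BoundedContinuousFunction.mkOfCompact (@fourier 1 n)).integrable μ
    simp_rw [hint]
    rw [← tsum_zero (α := ℂ) (β := ℕ)]
    refine tendsto_tsum_of_dominated_convergence (bound := fun j => ((1 / 2 : NNReal) ^ j : NNReal))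
      (NNReal.summable_coe.2 hgeom) (fun j => ?_) (Eventually.of_forall fun n j => ?_)
    · simpa using (hν j).2.const_smul (c j)
    · rw [NNReal.smul_def, norm_smul, Real.norm_of_nonneg (c j).coe_nonneg]
      refine le_trans ?_ (NNReal.coe_le_coe.2 (hcν j))
      rw [NNReal.coe_mul]
      refine mul_le_mul_of_nonneg_left ?_ (c j).2
      refine (norm_integral_le_of_norm_le_const (C := 1)
        (ae_of_all _ fun s => (norm_fourier_apply n s).le)).trans ?_
      rw [one_mul]; rfl
  · refine Measure.AbsolutelyContinuous.mk fun s hs h => ?_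
    have h1 := (Measure.sum_apply_eq_zero.1 h) j
    rw [Measure.smul_apply, ENNReal.smul_def, smul_eq_mul, mul_eq_zero] at h1
    exact h1.resolve_left (by simpa using hc0 j)

/-- A finite measure on the torus whose Fourier coefficients are concentrated on the antidiagonal
is the image of a product measure. -/
theorem eq_map_prod_of_integral_eq_zero {σ : Measure (𝕋 × 𝕋)} [IsFiniteMeasure σ]
    (h : ∀ m n : ℤ, m + n ≠ 0 → ∫ z, (fourier m z.1 : ℂ) * fourier n z.2 ∂σ = 0) :
    σ = ((haar).prod (σ.map fun z => z.1 - z.2)).map fun p : 𝕋 × 𝕋 => (p.1, p.1 - p.2) := by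
  have hd : Measurable fun z : 𝕋 × 𝕋 => z.1 - z.2 := by fun_prop
  have hΦ : Measurable fun p : 𝕋 × 𝕋 => (p.1, p.1 - p.2) := by fun_prop
  refine ext_of_integral_fourier_mul_fourier fun m n => ?_
  have hc : ∀ k l : ℤ, Continuous fun z : 𝕋 × 𝕋 => (fourier k z.1 : ℂ) * fourier l z.2 :=
    fun k l => by fun_prop
  rw [integral_map hΦ.aemeasurable (hc m n).aestronglyMeasurable]
  have h1 : ∀ p : 𝕋 × 𝕋, (fourier m p.1 : ℂ) * fourier n (p.1 - p.2) =
      fourier (m + n) p.1 * fourier (-n) p.2 := by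
    intro p
    rw [fourier_sub_apply, fourier_add]
    ring
  simp_rw [h1]
  rw [integral_prod_mul (fun t => (fourier (m + n) t : ℂ)) (fun r => (fourier (-n) r : ℂ)),
    integral_fourier_haarAddCircle]
  -- The Haar integral of `fourier (m + n)` is one on the antidiagonal and zero off it, matching the
  -- hypothesis on `σ`.
  by_cases hmn : m + n = 0
  · rw [if_pos hmn, one_mul, integral_map hd.aemeasurable
      (map_continuous (fourier (-n))).aestronglyMeasurable]
    congr 1
    ext z
    rw [fourier_sub_apply, neg_neg, show m = -n by omega]
  · rw [if_neg hmn, zero_mul, h m n hmn]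

end Circle

/-! ### The measure class of `L²(M)` off the diagonal. -/

section Main

local notation "𝕋" => UnitAddCircle
local notation "haar" => (AddCircle.haarAddCircle : Measure UnitAddCircle)

variable {H : Type*} [NormedAddCommGroup H] [InnerProductSpace ℂ H] [CompleteSpace H]
  {N : VonNeumannAlgebra H} {α : IntAction N} {τ : PositiveFunctional N}
  {F : MeasurableHilbertField (𝕋 × 𝕋)} {ρ : Measure (𝕋 × 𝕋)}

/-- The direct integral isomorphism turns left and right multiplication by the canonical unitary
into multiplication by the coordinate functions. -/
def IsBimodular (U : DirectIntegralIso F ρ (crossedTrace τ α).L2) : Prop :=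
  ∀ (m n : ℤ) (y : Elem (crossedProduct α)), ∀ᵐ z ∂ρ,
    U.toSection ((crossedTrace τ α).toL2
      (((canonicalUnitary α ^ m : unitary (Elem (crossedProduct α))) : Elem (crossedProduct α)) * y *
        ((canonicalUnitary α ^ n : unitary (Elem (crossedProduct α))) :
          Elem (crossedProduct α)))) z =
      ((fourier m z.1 : ℂ) * (fourier n z.2 : ℂ)) • U.toSection ((crossedTrace τ α).toL2 y) z

variable {U : DirectIntegralIso F ρ (crossedTrace τ α).L2}

/-- Since `u 1 u⁻¹ = 1`, the section `f` of the vector `1` satisfies `f(t, s) = t s⁻¹ f(t, s)`,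
which forces `f = 0` where `t ≠ s`. -/
theorem IsBimodular.one_mem_vanishingOn (hU : IsBimodular U) {E : Set (𝕋 × 𝕋)}
    (hE : E ⊆ (Set.diagonal 𝕋)ᶜ) : (crossedTrace τ α).toL2 1 ∈ U.vanishingOn E := by
  have h := hU 1 (-1) 1
  have h1 : (((canonicalUnitary α ^ (1 : ℤ) : unitary (Elem (crossedProduct α))) :
      Elem (crossedProduct α)) * 1 *
        ((canonicalUnitary α ^ (-1 : ℤ) : unitary (Elem (crossedProduct α))) :
          Elem (crossedProduct α))) = 1 := by
    rw [mul_one, ← Submonoid.coe_mul, ← zpow_add]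
    rfl
  rw [h1] at h
  refine U.mem_vanishingOn.2 ?_
  filter_upwards [h] with z hz hzE
  by_contra hne
  have h2 : ((fourier 1 z.1 : ℂ) * (fourier (-1) z.2 : ℂ) - 1) •
      U.toSection ((crossedTrace τ α).toL2 1) z = 0 := by
    rw [sub_smul, one_smul, ← hz, sub_self]
  have h3 := (smul_eq_zero.1 h2).resolve_right hne
  refine hE hzE (fourier_one_injective ?_)
  rw [sub_eq_zero, fourier_neg] at h3
  have h4 : (starRingEnd ℂ) (fourier 1 z.2) * fourier 1 z.2 = 1 := by
    rw [← Complex.normSq_eq_conj_mul_self, Complex.normSq_eq_norm_sq, norm_fourier_apply]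
    simp
  calc (fourier 1 z.1 : ℂ) = fourier 1 z.1 * ((starRingEnd ℂ) (fourier 1 z.2) * fourier 1 z.2) := by
        rw [h4, mul_one]
    _ = fourier 1 z.2 := by rw [← mul_assoc, h3, one_mul]

/-- Split `w` as a trace-zero part plus a scalar; multiplication by `u_k` scales sections pointwise
and so preserves vanishing. -/
theorem IsBimodular.coeffVec_mem_vanishingOn (hU : IsBimodular U) {E : Set (𝕋 × 𝕋)}
    (p : ℤ × Elem N)
    (h : (crossedTrace τ α).toL2 (piElem α (p.2 - τ p.2 • 1)) ∈ U.vanishingOn E)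
    (h1 : (crossedTrace τ α).toL2 1 ∈ U.vanishingOn E) :
    coeffVec α (crossedTrace τ α) p ∈ U.vanishingOn E := by
  have h2 : (crossedTrace τ α).toL2 (piElem α p.2) ∈ U.vanishingOn E := by
    have : piElem α p.2 = piElem α (p.2 - τ p.2 • 1) + τ p.2 • 1 := by
      rw [← piElem_one, ← piElem_smul, ← piElem_add, sub_add_cancel]
    rw [this, PositiveFunctional.toL2_add, PositiveFunctional.toL2_smul]
    exact add_mem h (Submodule.smul_mem _ _ h1)
  have h3 := hU p.1 0 (piElem α p.2)
  rw [zpow_zero, OneMemClass.coe_one, mul_one] at h3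
  refine U.mem_vanishingOn.2 ?_
  filter_upwards [h3, U.mem_vanishingOn.1 h2] with z h4 h5 hz
  change U.toSection ((crossedTrace τ α).toL2 _) z = 0
  rw [h4, h5 hz, smul_zero]

/-- Off the diagonal, the measure class of the direct integral is determined by countably many
elements of `N` of trace zero. -/
theorem IsBimodular.exists_seq (hU : IsBimodular U) [IsFiniteMeasure ρ]
    (hF : ∀ᵐ z ∂ρ, Nontrivial (F.fiber z)) (hτ : τ.IsFaithfulNormalTracialState) :
    ∃ x : ℕ → Elem N, (∀ j, τ (x j) = 0) ∧
      ∀ E : Set (𝕋 × 𝕋), MeasurableSet E → E ⊆ (Set.diagonal 𝕋)ᶜ →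
        (∀ j, (crossedTrace τ α).toL2 (piElem α (x j)) ∈ U.vanishingOn E) → ρ E = 0 := by
  obtain ⟨ζ, hζ⟩ := U.exists_seq_of_nontrivial hF
  have hcl : ∀ i, ζ i ∈ (Submodule.span ℂ
      (Set.range (coeffVec α (crossedTrace τ α)))).topologicalClosure := fun i => by
    rw [topologicalClosure_span_coeffVec α hτ]; trivial
  choose C hC hCζ using fun i => exists_countable_mem_closure_span (hcl i)
  -- Inserting `0` only ensures that the countable index set is nonempty, so that it is the range of
  -- a sequence.
  obtain ⟨d, hd⟩ := ((Set.countable_iUnion hC).insert (0 : ℤ × Elem N)).exists_eq_range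
    (Set.insert_nonempty _ _)
  refine ⟨fun j => (d j).2 - τ (d j).2 • 1, fun j => ?_, fun E hE hEd h => hζ E fun i => ?_⟩
  · rw [_root_.map_sub, _root_.map_smul, hτ.map_one, smul_eq_mul, mul_one, sub_self]
  · have hle : Submodule.span ℂ (coeffVec α (crossedTrace τ α) '' C i) ≤ U.vanishingOn E := by
      rw [Submodule.span_le]
      rintro _ ⟨p, hp, rfl⟩
      have hpd : p ∈ Set.range d := by
        rw [← hd]
        exact Set.mem_insert_of_mem _ (Set.mem_iUnion.2 ⟨i, hp⟩)
      obtain ⟨j, rfl⟩ := hpd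
      exact hU.coeffVec_mem_vanishingOn _ (h j) (hU.one_mem_vanishingOn hEd)
    exact Submodule.topologicalClosure_minimal _ hle (U.isClosed_vanishingOn hE) (hCζ i)

/-- The spectral measure of `L(ℤ)` acting from both sides on the vector of an element of `N`. -/
def vectorMeasure (U : DirectIntegralIso F ρ (crossedTrace τ α).L2) (x : Elem N) :
    Measure (𝕋 × 𝕋) :=
  ρ.withDensity fun z =>
    ENNReal.ofReal (‖U.toSection ((crossedTrace τ α).toL2 (piElem α x)) z‖ ^ 2)

instance isFiniteMeasure_vectorMeasure (x : Elem N) : IsFiniteMeasure (vectorMeasure U x) := by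
  refine isFiniteMeasure_withDensity_ofReal ?_
  exact (U.isL2Section _).integrable.2

theorem mem_vanishingOn_of_vectorMeasure_eq_zero {x : Elem N} {E : Set (𝕋 × 𝕋)}
    (hE : MeasurableSet E) (h : vectorMeasure U x E = 0) :
    (crossedTrace τ α).toL2 (piElem α x) ∈ U.vanishingOn E := by
  rw [vectorMeasure, withDensity_apply _ hE, lintegral_eq_zero_iff'
    (U.isL2Section _).integrable.aemeasurable.ennreal_ofReal.restrict] at h
  refine U.mem_vanishingOn.2 ?_
  filter_upwards [(ae_restrict_iff' hE).1 h] with z hz hzE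
  have := hz hzE
  rw [Pi.zero_apply, ENNReal.ofReal_eq_zero] at this
  simpa using le_antisymm this (by positivity)

/-- Both sides are `⟪x, u_m x u_n⟫`, computed in the direct integral and by the trace. -/
theorem IsBimodular.integral_vectorMeasure (hU : IsBimodular U) (x : Elem N) (m n : ℤ) :
    ∫ z, (fourier m z.1 : ℂ) * fourier n z.2 ∂(vectorMeasure U x) =
      if m + n = 0 then τ (star x * α.at m x) else 0 := by
  have h := (crossedTrace τ α).inner_toL2 (piElem α x)
    (((canonicalUnitary α ^ m : unitary (Elem (crossedProduct α))) : Elem (crossedProduct α)) *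
      piElem α x *
        ((canonicalUnitary α ^ n : unitary (Elem (crossedProduct α))) :
          Elem (crossedProduct α)))
  rw [crossedTrace_apply, condExpN_piElem_conj, U.inner_eq_integral, apply_ite τ,
    _root_.map_zero] at h
  rw [← h, vectorMeasure, integral_withDensity_eq_integral_toReal_smul₀
    (U.isL2Section _).integrable.aemeasurable.ennreal_ofReal (by simp)]
  refine integral_congr_ae ?_
  filter_upwards [hU m n (piElem α x)] with z hz
  rw [hz, inner_smul_right, inner_self_eq_norm_sq_to_K, ENNReal.toReal_ofReal (by positivity),
    Complex.real_smul, mul_comm]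
  simp

/-- The `n`-th coefficient is `τ(x⋆ α_n(x))`, which tends to `τ(x⋆) τ(x) = 0`. Trace zero is
essential to this limit. -/
theorem IsBimodular.isMixingMeasure_map_sub (hU : IsBimodular U) (hmix : α.IsMixing τ)
    {x : Elem N} (hx : τ x = 0) :
    IsMixingMeasure ((vectorMeasure U x).map fun z => z.1 - z.2) := by
  refine ⟨inferInstance, ?_⟩
  have h := hmix (star x) x
  rw [hx, mul_zero] at h
  refine h.congr fun n => ?_
  rw [integral_map (by fun_prop) (map_continuous (fourier n)).aestronglyMeasurable]
  simp_rw [fourier_sub_apply]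
  rw [hU.integral_vectorMeasure, if_pos (add_neg_cancel n)]

/-- A set null for the sheared product of Haar measure and the dominating `ν` is null for every
vector measure of the trace-zero sequence, so all those sections vanish on its off-diagonal part,
which is therefore `ρ`-null. -/
theorem IsBimodular.exists_isMixingMeasure_absolutelyContinuous (hU : IsBimodular U)
    [IsFiniteMeasure ρ] (hF : ∀ᵐ z ∂ρ, Nontrivial (F.fiber z))
    (hτ : τ.IsFaithfulNormalTracialState) (hmix : α.IsMixing τ) :
    ∃ ν : Measure 𝕋, IsMixingMeasure ν ∧ ρ.restrict (Set.diagonal 𝕋)ᶜ ≪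
      ((haar).prod ν).map fun p : 𝕋 × 𝕋 => (p.1, p.1 - p.2) := by
  obtain ⟨x, hx, hnull⟩ := hU.exists_seq hF hτ
  obtain ⟨ν, hν, hac⟩ := exists_isMixingMeasure_forall_absolutelyContinuous
    fun j => hU.isMixingMeasure_map_sub hmix (hx j)
  have := hν.1
  refine ⟨ν, hν, Measure.AbsolutelyContinuous.mk fun E hE h => ?_⟩
  have hΦ : Measurable fun p : 𝕋 × 𝕋 => (p.1, p.1 - p.2) := by fun_prop
  have hdiag : MeasurableSet (Set.diagonal 𝕋)ᶜ := isClosed_diagonal.measurableSet.compl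
  rw [Measure.restrict_apply hE]
  refine hnull _ (hE.inter hdiag) Set.inter_subset_right fun j => ?_
  refine mem_vanishingOn_of_vectorMeasure_eq_zero (hE.inter hdiag)
    (measure_mono_null Set.inter_subset_left ?_)
  rw [eq_map_prod_of_integral_eq_zero (σ := vectorMeasure U (x j)) fun m n hmn => by
    rw [hU.integral_vectorMeasure, if_neg hmn]]
  exact (((Measure.AbsolutelyContinuous.refl haar).prod (hac j)).map hΦ) h

end Main

end CrossedMixing

end

open CrossedMixing
theorem theorem5p1 {H : Type*} [NormedAddCommGroup H] [InnerProductSpace ℂ H] [CompleteSpace H]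
    [TopologicalSpace.SeparableSpace H]
    (N : VonNeumannAlgebra H) (hN : IsDiffuse N)
    (τ : PositiveFunctional N) (hτ : τ.IsFaithfulNormalTracialState)
    (α : IntAction N) (hpres : α.Preserves τ) (hfree : α.IsFree) (hmix : α.IsMixing τ)
    (η : Measure (UnitAddCircle × UnitAddCircle))
    (hη : IsLeftRightMeasure (crossedTrace τ α) (canonicalUnitary α) η) :
    (∃ κ : UnitAddCircle → Measure (UnitAddCircle × UnitAddCircle),
      IsDisintegration η Prod.fst AddCircle.haarAddCircle κ) ∧
    ∀ κ : UnitAddCircle → Measure (UnitAddCircle × UnitAddCircle),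
      IsDisintegration η Prod.fst AddCircle.haarAddCircle κ →
        ∀ᵐ t ∂(AddCircle.haarAddCircle : Measure UnitAddCircle),
          IsMixingMeasure (fiberMeasure (κ t) t) := by
  obtain ⟨hfin, ρ, hρ, F, U, hF, hU, hac, -⟩ := hη
  obtain ⟨ν, hν, hρν⟩ := IsBimodular.exists_isMixingMeasure_absolutelyContinuous (U := U) hU hF
    hτ hmix
  exact exists_disintegration_and_ae_isMixingMeasure hν (hac.trans hρν)
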